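/- Let $p$ be a power of an odd prime number, let $\mathbb{F}_q$ be a finite field containing $\mathbb{F}_p$, and let $\mathbb{F}$ be an algebraic closure of $\mathbb{F}_q$. Let $e\ge 0$ and let $R(x)=\sum_{i=0}^{e}a_i x^{p^i}\in\mathbb{F}_q[x]$ with $a_e\neq 0$. Let $C_R$ be the affine plane curve $y^p-y=xR(x)$ over $\mathbb{F}_q$, and put $$E_R(x)=R(x)^{p^e}+\sum_{i=0}^{e}(a_ix)^{p^{e-i}},\qquad f_R(x,y)=-\sum_{i=0}^{e-1}\Bigl(\sum_{j=0}^{e-i-1}(a_ix^{p^i}y)^{p^j}+(xR(y))^{p^i}\Bigr).$$ Let $V_R=\{x\in\mathbb{F}\mid E_R(x)=0\}$, an $\mathbb{F}_p$-vector space, and let $\omega_R(x,y)=f_R(x,y)-f_R(y,x)$ for $x,y\in V_R$. Let $H_R=\{(a,b)\in V_R\times\mathbb{F}\mid b^p-b=aR(a)\}$, a group under $(a,b)\cdot(a',b')=(a+a',\,b+b'+f_R(a,a'))$, which acts on $C_{R,\mathbb{F}}$ from the right by $(x,y)\cdot(a,b)=(x+a,\,y+f_R(x,a)+b)$. Let $A\subset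 V_R$ be an $\mathbb{F}_p$-subspace that is maximal among the subspaces totally isotropic with respect to $\omega_R$, and identify $A$ with an abelian subgroup of $H_R$ by the group homomorphism $a\mapsto(a,f_R(a,a)/2)$. Put $$c_A=(-1)^e\,\frac{a_e}{2}\prod_{\alpha\in A\setminus\{0\}}\alpha^{-1}\ \text{ if } e\ge 1,\qquad c_A=a_0\ \text{ if } e=0.$$ Let $k$ be any field with $\mathbb{F}_q\subset k\subset\mathbb{F}$ and $A\subset k$ (for instance $k=\mathbb{F}$, or $k=\mathbb{F}_q$ if $A\subset\mathbb{F}_q$). Then $c_A\in k$, the action of $A$ on $C_R$ is defined over $k$, and the quotient $C_{R,k}/A$ (the spectrum of the ring of $A$-invariant functions on $C_{R,k}$) is isomorphic over $k$ to the affine curve $y^p-y=c_Ax^2$. -/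

import Mathlib

/-!  The curves of van der Geer and van der Vlugt, their Heisenberg groups, and the quotients of
these curves by subgroups of the Heisenberg group.

Throughout, `Fp` is a finite field with `p` elements (`p` any prime power), `K` is a field
containing `Fp` and the coefficients `a 0, ..., a e` of the additive polynomial
`R(x) = ∑ i ≤ e, a i * x ^ (p ^ i)` lie in `K`. (The values `a i` for `i > e` are never used.)
The polynomials `R`, `E`, `f` are given by their values on arbitrary commutative `K`-algebras. -/

namespace VanDerGeerVlugt

open Finset

section Polynomials

variable {K : Type*} [Field K] {B : Type*} [CommRing B] [Algebra K B]

/-- `R(x) = ∑_{i=0}^e a_i x^{p^i}`. -/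
def R (p e : ℕ) (a : ℕ → K) (x : B) : B :=
  ∑ i ∈ range (e + 1), algebraMap K B (a i) * x ^ p ^ i

/-- `E_R(x) = R(x)^{p^e} + ∑_{i=0}^e (a_i x)^{p^{e-i}}`. -/
def E (p e : ℕ) (a : ℕ → K) (x : B) : B :=
  R p e a x ^ p ^ e + ∑ i ∈ range (e + 1), (algebraMap K B (a i) * x) ^ p ^ (e - i)

/-- `f_R(x,y) = - ∑_{i=0}^{e-1} ( ∑_{j=0}^{e-i-1} (a_i x^{p^i} y)^{p^j} + (x R(y))^{p^i} )`. -/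
def f (p e : ℕ) (a : ℕ → K) (x y : B) : B :=
  -∑ i ∈ range e, ((∑ j ∈ range (e - i), (algebraMap K B (a i) * x ^ p ^ i * y) ^ p ^ j)
    + (x * R p e a y) ^ p ^ i)

/-- `ω_R(x,y) = f_R(x,y) - f_R(y,x)`. -/
def omega (p e : ℕ) (a : ℕ → K) (x y : B) : B := f p e a x y - f p e a y x

variable {B' : Type*} [CommRing B'] [Algebra K B'] (φ : B →ₐ[K] B')

theorem map_R (p e : ℕ) (a : ℕ → K) (x : B) : φ (R p e a x) = R p e a (φ x) := by
  simp [R]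

theorem map_E (p e : ℕ) (a : ℕ → K) (x : B) : φ (E p e a x) = E p e a (φ x) := by
  simp [E, map_R]

theorem map_f (p e : ℕ) (a : ℕ → K) (x y : B) : φ (f p e a x y) = f p e a (φ x) (φ y) := by
  simp [f, map_R]

end Polynomials

section Identities

variable (Fp : Type*) [Field Fp] [Fintype Fp] {K : Type*} [Field K]
  {B : Type*} [CommRing B] [Algebra Fp B] [Algebra K B]

local notation "p" => Fintype.card Fp

theorem add_pow_p (x y : B) : (x + y) ^ p = x ^ p + y ^ p := by
  simpa using map_add (FiniteField.frobeniusAlgHom Fp B) x y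

theorem neg_pow_p (x : B) : (-x) ^ p = -x ^ p := by
  simpa using map_neg (FiniteField.frobeniusAlgHom Fp B) x

theorem sub_pow_p (x y : B) : (x - y) ^ p = x ^ p - y ^ p := by
  simpa using map_sub (FiniteField.frobeniusAlgHom Fp B) x y

theorem sum_pow_p {ι : Type*} (s : Finset ι) (g : ι → B) :
    (∑ i ∈ s, g i) ^ p = ∑ i ∈ s, g i ^ p := by
  exact map_sum (FiniteField.frobeniusAlgHom Fp B) g s

theorem algebraMap_pow_p (ξ : Fp) : algebraMap Fp B ξ ^ p = algebraMap Fp B ξ := by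
  rw [← map_pow, FiniteField.pow_card]

theorem algebraMap_pow_p_pow (ξ : Fp) (i : ℕ) :
    algebraMap Fp B ξ ^ p ^ i = algebraMap Fp B ξ := by
  rw [← map_pow, FiniteField.pow_card_pow]

theorem add_pow_p_pow (i : ℕ) (x y : B) : (x + y) ^ p ^ i = x ^ p ^ i + y ^ p ^ i := by
  induction i with
  | zero => simp
  | succ i ih => rw [pow_succ, pow_mul, ih, add_pow_p, ← pow_mul, ← pow_mul]

variable (e : ℕ) (a : ℕ → K)

theorem R_add (x y : B) : R p e a (x + y) = R p e a x + R p e a y := by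
  simp only [R, add_pow_p_pow, mul_add, sum_add_distrib]

theorem E_add (x y : B) : E p e a (x + y) = E p e a x + E p e a y := by
  simp only [E, R_add, add_pow_p_pow, mul_add, sum_add_distrib]
  ring

theorem f_add_left (x x' y : B) : f p e a (x + x') y = f p e a x y + f p e a x' y := by
  simp only [f, add_pow_p_pow, mul_add, add_mul, sum_add_distrib]
  ring

theorem f_add_right (x y y' : B) : f p e a x (y + y') = f p e a x y + f p e a x y' := by
  simp only [f, R_add, add_pow_p_pow, mul_add, sum_add_distrib]
  ring

theorem R_smul (ξ : Fp) (x : B) : R p e a (ξ • x) = ξ • R p e a x := by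
  simp only [R, Algebra.smul_def, mul_pow, algebraMap_pow_p_pow, mul_sum]
  exact sum_congr rfl fun i _ => by ring

theorem E_smul (ξ : Fp) (x : B) : E p e a (ξ • x) = ξ • E p e a x := by
  simp only [E, R_smul]
  simp only [Algebra.smul_def, mul_pow, algebraMap_pow_p_pow, mul_sum, mul_add]
  congr 1
  exact sum_congr rfl fun i _ => by ring

theorem R_zero : R p e a (0 : B) = 0 := by simpa using R_add Fp e a (0 : B) 0

theorem E_zero : E p e a (0 : B) = 0 := by simpa using E_add Fp e a (0 : B) 0

theorem f_zero_left (y : B) : f p e a 0 y = 0 := by simpa using f_add_left Fp e a 0 0 y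

theorem f_zero_right (x : B) : f p e a x 0 = 0 := by simpa using f_add_right Fp e a x 0 0

theorem R_neg (x : B) : R p e a (-x) = -R p e a x := by
  rw [eq_neg_iff_add_eq_zero, ← R_add, neg_add_cancel, R_zero]

theorem E_neg (x : B) : E p e a (-x) = -E p e a x := by
  rw [eq_neg_iff_add_eq_zero, ← E_add, neg_add_cancel, E_zero]

theorem f_neg_left (x y : B) : f p e a (-x) y = -f p e a x y := by
  rw [eq_neg_iff_add_eq_zero, ← f_add_left, neg_add_cancel, f_zero_left]

theorem f_neg_right (x y : B) : f p e a x (-y) = -f p e a x y := by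
  rw [eq_neg_iff_add_eq_zero, ← f_add_right, neg_add_cancel, f_zero_right]

/-- `f_R(x,y)^p - f_R(x,y) = -x^{p^e} E_R(y) + x R(y) + y R(x)`. -/
theorem f_pow_sub (x y : B) :
    f p e a x y ^ p - f p e a x y
      = -x ^ p ^ e * E p e a y + x * R p e a y + y * R p e a x := by
  have tel : ∀ (n : ℕ) (z : B),
      (∑ j ∈ range n, z ^ p ^ j) ^ p - ∑ j ∈ range n, z ^ p ^ j = z ^ p ^ n - z := by
    intro n z
    rw [sum_pow_p, ← sum_sub_distrib]
    simp only [← pow_mul, ← pow_succ]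
    rw [sum_range_sub (fun j => z ^ p ^ j)]
    simp
  have h1 : f p e a x y = -((∑ i ∈ range e, ∑ j ∈ range (e - i),
      (algebraMap K B (a i) * x ^ p ^ i * y) ^ p ^ j)
      + ∑ i ∈ range e, (x * R p e a y) ^ p ^ i) := by
    rw [f, sum_add_distrib]
  have h2 : (∑ i ∈ range e, ∑ j ∈ range (e - i),
      (algebraMap K B (a i) * x ^ p ^ i * y) ^ p ^ j) ^ p
      - ∑ i ∈ range e, ∑ j ∈ range (e - i), (algebraMap K B (a i) * x ^ p ^ i * y) ^ p ^ j
      = x ^ p ^ e * (∑ i ∈ range e, (algebraMap K B (a i) * y) ^ p ^ (e - i))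
        - y * ∑ i ∈ range e, algebraMap K B (a i) * x ^ p ^ i := by
    rw [sum_pow_p, ← sum_sub_distrib, mul_sum, mul_sum, ← sum_sub_distrib]
    refine sum_congr rfl fun i hi => ?_
    rw [tel]
    have : p ^ e = p ^ i * p ^ (e - i) := by
      rw [← pow_add, Nat.add_sub_cancel' (mem_range.mp hi).le]
    rw [this, pow_mul x, ← mul_pow]
    ring
  have h3 := tel e (x * R p e a y)
  have h4 : R p e a x = (∑ i ∈ range e, algebraMap K B (a i) * x ^ p ^ i)
      + algebraMap K B (a e) * x ^ p ^ e := by rw [R, sum_range_succ]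
  have h5 : E p e a y = R p e a y ^ p ^ e
      + ((∑ i ∈ range e, (algebraMap K B (a i) * y) ^ p ^ (e - i))
        + algebraMap K B (a e) * y) := by
    rw [E, sum_range_succ]; simp
  rw [h1, neg_pow_p, add_pow_p, h5, h4]
  rw [mul_pow] at h3
  linear_combination -h2 - h3

end Identities

section Heisenberg

variable (Fp : Type*) [Field Fp] [Fintype Fp] {K : Type*} [Field K] (e : ℕ) (a : ℕ → K)

local notation "p" => Fintype.card Fp

/-- The elements `(α, β)` of `B²` with `E_R(α) = 0` and `β^p - β = α R(α)`. For `B` an algebraic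
closure of `K` this is the Heisenberg group `H_R`; in general it consists of the elements
with coordinates in `B`. -/
@[ext]
structure H (B : Type*) [CommRing B] [Algebra K B] where
  fst : B
  snd : B
  root : E (Fintype.card Fp) e a fst = 0
  eqn : snd ^ Fintype.card Fp - snd = fst * R (Fintype.card Fp) e a fst

namespace H

variable {Fp e a} {B : Type*} [CommRing B] [Algebra Fp B] [Algebra K B]

/-- `(α, β) (α', β') = (α + α', β + β' + f_R(α, α'))`. -/
instance : Mul (H Fp e a B) where
  mul g h :=
    { fst := g.fst + h.fst
      snd := g.snd + h.snd + f p e a g.fst h.fst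
      root := by rw [E_add, g.root, h.root, add_zero]
      eqn := by
        have h1 := f_pow_sub Fp e a g.fst h.fst
        rw [h.root] at h1
        rw [add_pow_p, add_pow_p, R_add]
        linear_combination g.eqn + h.eqn + h1 }

instance : One (H Fp e a B) where
  one :=
    { fst := 0
      snd := 0
      root := E_zero Fp e a
      eqn := by simp [Fintype.card_ne_zero] }

instance : Inv (H Fp e a B) where
  inv g :=
    { fst := -g.fst
      snd := f p e a g.fst g.fst - g.snd
      root := by rw [E_neg, g.root, neg_zero]
      eqn := by
        have h1 := f_pow_sub Fp e a g.fst g.fst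
        rw [g.root] at h1
        rw [sub_pow_p, R_neg]
        linear_combination h1 - g.eqn }

@[simp] theorem mul_fst (g h : H Fp e a B) : (g * h).fst = g.fst + h.fst := rfl
@[simp] theorem mul_snd (g h : H Fp e a B) :
    (g * h).snd = g.snd + h.snd + f p e a g.fst h.fst := rfl
@[simp] theorem one_fst : (1 : H Fp e a B).fst = 0 := rfl
@[simp] theorem one_snd : (1 : H Fp e a B).snd = 0 := rfl
@[simp] theorem inv_fst (g : H Fp e a B) : g⁻¹.fst = -g.fst := rfl
@[simp] theorem inv_snd (g : H Fp e a B) : g⁻¹.snd = f p e a g.fst g.fst - g.snd := rfl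

instance : Group (H Fp e a B) :=
  Group.ofLeftAxioms
    (fun g h l => H.ext (by simp [add_assoc]) (by
      simp only [mul_snd, mul_fst, f_add_left, f_add_right]; ring))
    (fun g => H.ext (by simp) (by simp [f_zero_left]))
    (fun g => H.ext (by simp) (by simp [f_neg_left]))

/-- Functoriality of the Heisenberg group in the algebra of coordinates. -/
def map {B' : Type*} [CommRing B'] [Algebra Fp B'] [Algebra K B'] (φ : B →ₐ[K] B') :
    H Fp e a B →* H Fp e a B' where
  toFun g :=
    { fst := φ g.fst
      snd := φ g.snd
      root := by rw [← map_E, g.root, map_zero]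
      eqn := by rw [← map_pow, ← map_sub, g.eqn, map_mul, map_R] }
  map_one' := H.ext (by simp) (by simp)
  map_mul' g h := H.ext (by simp) (by simp [map_f])

end H

end Heisenberg

section Isotropic

variable (Fp : Type*) [Field Fp] [Fintype Fp] {K : Type*} [Field K] (e : ℕ) (a : ℕ → K)
  (F : Type*) [Field F] [Algebra Fp F] [Algebra K F]

/-- The `Fp`-vector space `V_R = {x ∈ F | E_R(x) = 0}`. -/
def V : Submodule Fp F where
  carrier := {x | E (Fintype.card Fp) e a x = 0}
  add_mem' {x y} hx hy := by
    simp only [Set.mem_ofPred_eq] at hx hy ⊢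
    rw [E_add, hx, hy, add_zero]
  zero_mem' := E_zero Fp e a
  smul_mem' ξ x hx := by
    simp only [Set.mem_ofPred_eq] at hx ⊢
    rw [E_smul, hx, smul_zero]

variable {Fp F}

/-- `A` is a subspace of `V_R` that is totally isotropic with respect to `ω_R`. -/
def IsTotallyIsotropic (A : Submodule Fp F) : Prop :=
  A ≤ V Fp e a F ∧ ∀ x ∈ A, ∀ y ∈ A, omega (Fintype.card Fp) e a x y = 0

theorem two_ne_zero_of_odd (hp : Odd (Fintype.card Fp)) : (2 : F) ≠ 0 := by
  have h2 : (2 : Fp) ≠ 0 := by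
    intro h
    have h1 : ((Fintype.card Fp : ℕ) : Fp) = 0 := Nat.cast_card_eq_zero Fp
    obtain ⟨m, hm⟩ := hp
    rw [hm] at h1
    push_cast at h1
    rw [h] at h1
    simp at h1
  intro h
  apply h2
  apply (algebraMap Fp F).injective
  rw [map_ofNat, map_zero, h]

variable {e a}

/-- For odd `p`, the group homomorphism `A → H_R`, `α ↦ (α, f_R(α, α) / 2)`, for a totally
isotropic subspace `A` of `V_R`. -/
def embed (hp : Odd (Fintype.card Fp)) {A : Submodule Fp F} (hA : IsTotallyIsotropic e a A) :
    Multiplicative A →* H Fp e a F where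
  toFun x :=
    { fst := (x.toAdd : F)
      snd := f (Fintype.card Fp) e a (x.toAdd : F) (x.toAdd : F) / 2
      root := hA.1 x.toAdd.2
      eqn := by
        have h2 : (2 : F) ≠ 0 := two_ne_zero_of_odd hp
        have h2p : (2 : F) ^ Fintype.card Fp = 2 := by
          have := algebraMap_pow_p Fp (B := F) 2
          rwa [map_ofNat] at this
        have hE : E (Fintype.card Fp) e a (x.toAdd : F) = 0 := hA.1 x.toAdd.2
        have h1 := f_pow_sub Fp e a (x.toAdd : F) (x.toAdd : F)
        rw [hE] at h1
        rw [div_pow, h2p]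
        field_simp
        linear_combination h1 }
  map_one' := H.ext (by simp) (by simp [f_zero_left])
  map_mul' x y := by
    have h2 : (2 : F) ≠ 0 := two_ne_zero_of_odd hp
    have hω : f (Fintype.card Fp) e a (x.toAdd : F) (y.toAdd : F)
        - f (Fintype.card Fp) e a (y.toAdd : F) (x.toAdd : F) = 0 :=
      hA.2 _ x.toAdd.2 _ y.toAdd.2
    refine H.ext (by simp) ?_
    simp only [toAdd_mul, Submodule.coe_add, f_add_left, f_add_right, H.mul_snd]
    field_simp
    linear_combination -hω

variable (e a)

/-- `c_A = (-1)^e (a_e / 2) ∏_{α ∈ A ∖ {0}} α⁻¹` for `e ≥ 1` and `c_A = a_0` for `e = 0`. (The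
product is finite, since `A ⊆ V_R` consists of roots of a nonzero polynomial.) -/
noncomputable def cA (A : Submodule Fp F) : F :=
  if e = 0 then algebraMap K F (a 0)
  else (-1) ^ e * (algebraMap K F (a e) / 2) * ∏ᶠ α ∈ {α : F | α ∈ A ∧ α ≠ 0}, α⁻¹

end Isotropic

section Curves

set_option linter.unusedSectionVars false

open Polynomial AlgebraicGeometry CategoryTheory

/-- The coordinate ring `k[x,y] / (y^p - y - g(x))`. -/
abbrev CoordRing {k : Type*} [Field k] (p : ℕ) (g : k[X]) : Type _ :=
  MvPolynomial (Fin 2) k ⧸ Ideal.span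
    {(MvPolynomial.X 1 ^ p - MvPolynomial.X 1 - aeval (MvPolynomial.X 0) g :
      MvPolynomial (Fin 2) k)}

/-- The affine curve `y^p - y = g(x)` over `k`, as a scheme over `k`. -/
noncomputable def curve {k : Type*} [Field k] (p : ℕ) (g : k[X]) :
    Over (Spec (CommRingCat.of k)) :=
  Over.mk (Spec.map (CommRingCat.ofHom (algebraMap k (CoordRing p g))))

/-- The class of `x` in the coordinate ring. -/
noncomputable def xx {k : Type*} [Field k] (p : ℕ) (g : k[X]) : CoordRing p g :=
  Ideal.Quotient.mk _ (MvPolynomial.X 0)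

/-- The class of `y` in the coordinate ring. -/
noncomputable def yy {k : Type*} [Field k] (p : ℕ) (g : k[X]) : CoordRing p g :=
  Ideal.Quotient.mk _ (MvPolynomial.X 1)

theorem curve_eqn {k : Type*} [Field k] (p : ℕ) (g : k[X]) :
    yy p g ^ p - yy p g = aeval (xx p g) g := by
  have h1 : aeval (xx p g) g = Ideal.Quotient.mk _ (aeval (MvPolynomial.X 0) g) :=
    aeval_algHom_apply (Ideal.Quotient.mkₐ k _) (MvPolynomial.X 0) g
  rw [h1, ← sub_eq_zero]
  exact Ideal.Quotient.eq_zero_iff_mem.mpr (Ideal.subset_span rfl)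

variable {K : Type*} [Field K] (e : ℕ) (a : ℕ → K) (k : Type*) [Field k] [Algebra K k]

/-- The polynomial `x R(x)` over the extension `k` of the field of coefficients; the curve
`C_R` over `k` is `curve p (xR p e a k)`. -/
noncomputable def xR (p : ℕ) : k[X] := X * R p e a (X : k[X])

theorem aeval_xR (p : ℕ) {B : Type*} [CommRing B] [Algebra k B] [Algebra K B]
    [IsScalarTower K k B] (x : B) : aeval x (xR e a k p) = x * R p e a x := by
  have := map_R ((aeval x : k[X] →ₐ[k] B).restrictScalars K) p e a X
  simp only [AlgHom.coe_restrictScalars', aeval_X] at this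
  rw [xR, map_mul, aeval_X, this]

variable (Fp : Type*) [Field Fp] [Fintype Fp] [Algebra Fp k]

local notation "p" => Fintype.card Fp

/-- The coordinate ring `k[x,y] / (y^p - y - x R(x))` of `C_R` over `k`. -/
abbrev CR : Type _ := CoordRing p (xR e a k p)

variable {e a k Fp}

/-- Pull-back of functions along `(x, y) ↦ (x, y) · h = (x + α, y + f_R(x, α) + β)`
for `h = (α, β)`. -/
noncomputable def pullback (h : H Fp e a k) : CR e a k Fp →ₐ[k] CR e a k Fp :=
  Ideal.Quotient.liftₐ _
    (MvPolynomial.aeval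
      ![xx p (xR e a k p) + algebraMap k _ h.fst,
        yy p (xR e a k p) + f p e a (xx p (xR e a k p)) (algebraMap k _ h.fst)
          + algebraMap k _ h.snd])
    (by
      set x := xx p (xR e a k p)
      set y := yy p (xR e a k p)
      set α : CR e a k Fp := algebraMap k _ h.fst with hα
      have h0 : y ^ p - y = x * R p e a x := by rw [← aeval_xR e a k p, curve_eqn]
      have hE : E p e a α = 0 := by
        have := map_E (IsScalarTower.toAlgHom K k (CR e a k Fp)) p e a h.fst
        rw [h.root, map_zero] at this
        exact this.symm
      have hb : (algebraMap k (CR e a k Fp) h.snd) ^ p - algebraMap k (CR e a k Fp) h.snd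
          = α * R p e a α := by
        have := map_R (IsScalarTower.toAlgHom K k (CR e a k Fp)) p e a h.fst
        simp only [IsScalarTower.coe_toAlgHom'] at this
        rw [← map_pow, ← map_sub, h.eqn, map_mul, this]
      have h1 := f_pow_sub Fp e a x α
      rw [hE] at h1
      intro g hg
      rw [← RingHom.mem_ker]
      refine (Ideal.span_le.mpr ?_ : Ideal.span _ ≤ RingHom.ker _) hg
      rintro _ rfl
      have h2 := aeval_algHom_apply (MvPolynomial.aeval
        ![x + α, y + f p e a x α + algebraMap k _ h.snd] :
          MvPolynomial (Fin 2) k →ₐ[k] CR e a k Fp) (MvPolynomial.X 0) (xR e a k p)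
      rw [MvPolynomial.aeval_X, aeval_xR] at h2
      simp only [Matrix.cons_val_zero] at h2
      simp only [SetLike.mem_coe, RingHom.mem_ker, map_sub, map_pow, MvPolynomial.aeval_X,
        Matrix.cons_val_one, Matrix.cons_val_zero]
      erw [← h2]
      rw [add_pow_p, add_pow_p, R_add]
      linear_combination h0 + hb + h1)

theorem pullback_xx (h : H Fp e a k) :
    pullback h (xx p (xR e a k p)) = xx p (xR e a k p) + algebraMap k _ h.fst := by
  have : pullback h (xx p (xR e a k p)) = MvPolynomial.aeval
      ![xx p (xR e a k p) + algebraMap k (CR e a k Fp) h.fst,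
        yy p (xR e a k p) + f p e a (xx p (xR e a k p)) (algebraMap k _ h.fst)
          + algebraMap k _ h.snd] (MvPolynomial.X 0) := rfl
  rw [this, MvPolynomial.aeval_X]
  rfl

theorem pullback_yy (h : H Fp e a k) :
    pullback h (yy p (xR e a k p)) = yy p (xR e a k p)
      + f p e a (xx p (xR e a k p)) (algebraMap k _ h.fst) + algebraMap k _ h.snd := by
  have : pullback h (yy p (xR e a k p)) = MvPolynomial.aeval
      ![xx p (xR e a k p) + algebraMap k (CR e a k Fp) h.fst,
        yy p (xR e a k p) + f p e a (xx p (xR e a k p)) (algebraMap k _ h.fst)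
          + algebraMap k _ h.snd] (MvPolynomial.X 1) := rfl
  rw [this, MvPolynomial.aeval_X]
  rfl

theorem CR_hom_ext {φ ψ : CR e a k Fp →ₐ[k] CR e a k Fp}
    (hx : φ (xx p (xR e a k p)) = ψ (xx p (xR e a k p)))
    (hy : φ (yy p (xR e a k p)) = ψ (yy p (xR e a k p))) : φ = ψ := by
  refine Ideal.Quotient.algHom_ext _ (MvPolynomial.algHom_ext fun i => ?_)
  fin_cases i
  · exact hx
  · exact hy

theorem pullback_one : pullback (1 : H Fp e a k) = AlgHom.id k _ := by
  apply CR_hom_ext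
  · rw [pullback_xx]; simp
  · rw [pullback_yy]; simp [f_zero_right]

theorem pullback_mul (g h : H Fp e a k) : pullback (g * h) = (pullback g).comp (pullback h) := by
  have hf : ∀ x y : CR e a k Fp,
      pullback g (f p e a x y) = f p e a (pullback g x) (pullback g y) := fun x y =>
    map_f ((pullback g).restrictScalars K) p e a x y
  have hm := map_f (IsScalarTower.toAlgHom K k (CR e a k Fp)) p e a g.fst h.fst
  simp only [IsScalarTower.coe_toAlgHom'] at hm
  apply CR_hom_ext
  · rw [AlgHom.comp_apply, pullback_xx, pullback_xx, map_add, pullback_xx, AlgHom.commutes,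
      H.mul_fst, map_add]
    ring
  · rw [AlgHom.comp_apply, pullback_yy, pullback_yy, map_add, map_add, pullback_yy, hf,
      pullback_xx, AlgHom.commutes, AlgHom.commutes, H.mul_fst, H.mul_snd, map_add, map_add,
      map_add, hm, f_add_left, f_add_right]
    ring

/-- The action of the Heisenberg group on functions on `C_R`: the right action
`(x, y) · (α, β) = (x + α, y + f_R(x, α) + β)` on the curve gives a left action on functions. -/
noncomputable def action : H Fp e a k →* (CR e a k Fp ≃ₐ[k] CR e a k Fp) where
  toFun h := AlgEquiv.ofAlgHom (pullback h) (pullback h⁻¹)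
    (by rw [← pullback_mul, mul_inv_cancel, pullback_one])
    (by rw [← pullback_mul, inv_mul_cancel, pullback_one])
  map_one' := by
    ext z
    exact DFunLike.congr_fun pullback_one z
  map_mul' g h := by
    ext z
    exact DFunLike.congr_fun (pullback_mul g h) z

/-- The ring of functions on `C_R` that are invariant under the subgroup `G`. -/
noncomputable def invariants (G : Subgroup (H Fp e a k)) : Subalgebra k (CR e a k Fp) where
  carrier := {z | ∀ h ∈ G, action h z = z}
  add_mem' hx hy h hh := by rw [map_add, hx h hh, hy h hh]
  mul_mem' hx hy h hh := by rw [map_mul, hx h hh, hy h hh]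
  algebraMap_mem' c h _ := by rw [AlgEquiv.commutes]

/-- The quotient `C_R / G` of the affine curve `C_R` over `k` by a subgroup `G` of the
(finite) Heisenberg group: the spectrum of the ring of `G`-invariant functions. -/
noncomputable def quotientCurve (G : Subgroup (H Fp e a k)) : Over (Spec (CommRingCat.of k)) :=
  Over.mk (Spec.map (CommRingCat.ofHom (algebraMap k (invariants G))))

end Curves

end VanDerGeerVlugt

/-! Write `p = #Fp`. The function `v = y - f_R(x, x) / 2` satisfies `v^p - v = x^(p^e) E_R(x) / 2`,
and a translation by `α ∈ A` changes it by `ω_R(x, α) / 2`. It is made invariant by means of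
coordinates on `A`. As `ω_R` is a nondegenerate alternating form on the space `V_R`, whose dimension
is `2e`, a maximal totally isotropic subspace has dimension `e` (`finrank_of_maximal`). Let
`b_1, ..., b_e` be a basis of `A`. The Moore matrix `(b_i^(p^j))` is invertible, and its inverse `N`
yields additive polynomials `L_i` of degree less than `p^e` with `L_i(b_l) = δ_il`. Since
`ω_R(x, α) = ∑ L_i(α) ω_R(x, b_i)` for `α ∈ A`, the function
`w = v - (1/2) ∑ L_i(x) ω_R(x, b_i)` is invariant (`correction_comp`).

Put `u = x^(p^e) - ∑ b_i^(p^e) L_i(x) = ∏_{α ∈ A} (x - α)`. An additive polynomial of degree at most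
`p^e` that vanishes on `A` is a multiple of `u`. This gives `L_i^p - L_i = m_i u`, and with
`ω_R(x, b_i)^p - ω_R(x, b_i) = b_i^(p^e) E_R(x)` it follows that
`w^p - w = (u / 2) (E_R (1 - ∑ m_i b_i^(p^e)) - ∑ m_i ω_R(x, b_i))`. Comparison of coefficients
of `x` shows that `m_i = -N_{0i} / ∏_{α ≠ 0} α` and `∑ m_i b_i^(p^e) = 1`. Finally
`∑ N_{0i} ω_R(x, b_i)` has degree at most `p^e`, because all powers `b_i^(p^j)` with `0 < j < e`
cancel in `∑ N_{0i} f_R(b_i, x)`, so it equals `a_e u`; hence `w^p - w = c u^2` with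
`c = (a_e / 2) ∏_{α ≠ 0} α⁻¹` (`correction_artinSchreier`). For `e = 0` the group `A` is trivial,
`u = x` and `w = y`. The sign `(-1)^e` in `c_A` is absorbed by replacing `w` by `(-1)^e w`.

The invariants are generated by `u` and `w` (`nonempty_invariants_algEquiv`): every function on
`C_R` is a polynomial in `x` over `k[u, w]` of degree less than `#A`, and an invariant one takes the
same value at the `#A` points `x + α`, whose differences are units, so it is constant as a polynomial
in `x`. -/

universe u

namespace VanDerGeerVlugt

/-! ### The affine curves `y^p - y = g(x)` -/

section PlaneCurves

open Polynomial AlgebraicGeometry CategoryTheory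

variable {k : Type*} [Field k] {p : ℕ} {g : k[X]}

/-- The universal property of `k[x,y] / (y^p - y - g(x))`. -/
noncomputable def coordLift {S : Type*} [CommRing S] [Algebra k S] (s t : S)
    (h : t ^ p - t = aeval s g) : CoordRing p g →ₐ[k] S :=
  Ideal.Quotient.liftₐ _ (MvPolynomial.aeval ![s, t]) (by
    intro z hz
    rw [← RingHom.mem_ker]
    refine (Ideal.span_le.mpr ?_ : Ideal.span _ ≤ RingHom.ker _) hz
    rintro _ rfl
    have h2 := aeval_algHom_apply (MvPolynomial.aeval ![s, t] : MvPolynomial (Fin 2) k →ₐ[k] S)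
      (MvPolynomial.X 0) g
    rw [MvPolynomial.aeval_X] at h2
    simp only [Matrix.cons_val_zero] at h2
    simp only [SetLike.mem_coe, RingHom.mem_ker, map_sub, map_pow, MvPolynomial.aeval_X,
      Matrix.cons_val_one, Matrix.cons_val_zero]
    erw [← h2]
    rw [h, sub_self])

section

variable {S : Type*} [CommRing S] [Algebra k S] (s t : S) (h : t ^ p - t = aeval s g)

@[simp] theorem coordLift_xx : coordLift s t h (xx p g) = s :=
  MvPolynomial.aeval_X ![s, t] 0

@[simp] theorem coordLift_yy : coordLift s t h (yy p g) = t :=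
  MvPolynomial.aeval_X ![s, t] 1

theorem coordRing_hom_ext {φ ψ : CoordRing p g →ₐ[k] S}
    (hx : φ (xx p g) = ψ (xx p g)) (hy : φ (yy p g) = ψ (yy p g)) : φ = ψ := by
  refine Ideal.Quotient.algHom_ext _ (MvPolynomial.algHom_ext fun i => ?_)
  fin_cases i
  · exact hx
  · exact hy

end

theorem adjoin_xx_yy : Algebra.adjoin k {xx p g, yy p g} = ⊤ := by
  rw [eq_top_iff]
  rintro z -
  obtain ⟨P, rfl⟩ := Ideal.Quotient.mk_surjective z
  induction P using MvPolynomial.induction_on with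
  | C c => exact (Algebra.adjoin k {xx p g, yy p g}).algebraMap_mem c
  | add P Q hP hQ => rw [map_add]; exact add_mem hP hQ
  | mul_X P i hP =>
    rw [map_mul]
    refine mul_mem hP (Algebra.subset_adjoin ?_)
    fin_cases i
    · exact Or.inl rfl
    · exact Or.inr rfl

/-- Evaluation of a polynomial in `y` with coefficients in `k[x]` on the curve. -/
noncomputable def evalXY (p : ℕ) (g : k[X]) : k[X][X] →+* CoordRing p g :=
  eval₂RingHom (aeval (xx p g) : k[X] →ₐ[k] CoordRing p g).toRingHom (yy p g)

@[simp] theorem evalXY_C (q : k[X]) : evalXY p g (C q) = aeval (xx p g) q := by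
  simp [evalXY]

@[simp] theorem evalXY_X : evalXY p g X = yy p g := by
  simp [evalXY]

theorem monic_artinSchreier (hp : 1 < p) (q : k[X]) :
    (X ^ p - X - C q : k[X][X]).Monic := by
  rw [sub_sub]
  refine monic_X_pow_sub (n := p) ?_
  rw [degree_X_add_C]
  exact_mod_cast hp

theorem degree_artinSchreier (hp : 1 < p) (q : k[X]) :
    (X ^ p - X - C q : k[X][X]).degree = p := by
  rw [sub_sub, degree_sub_eq_left_of_degree_lt, degree_X_pow]
  rw [degree_X_pow, degree_X_add_C]
  exact_mod_cast hp

theorem exists_evalXY_eq (hp : 1 < p) (z : CoordRing p g) :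
    ∃ Q : k[X][X], Q.degree < p ∧ evalXY p g Q = z := by
  have hs : ∃ Q : k[X][X], evalXY p g Q = z := by
    have hz : z ∈ Algebra.adjoin k {xx p g, yy p g} := by rw [adjoin_xx_yy]; exact Algebra.mem_top
    induction hz using Algebra.adjoin_induction with
    | mem z hz =>
      rcases hz with rfl | rfl
      · exact ⟨C X, by simp⟩
      · exact ⟨X, by simp⟩
    | algebraMap c => exact ⟨C (C c), by simp⟩
    | add z w _ _ hz hw =>
      obtain ⟨P, rfl⟩ := hz
      obtain ⟨Q, rfl⟩ := hw
      exact ⟨P + Q, map_add _ _ _⟩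
    | mul z w _ _ hz hw =>
      obtain ⟨P, rfl⟩ := hz
      obtain ⟨Q, rfl⟩ := hw
      exact ⟨P * Q, map_mul _ _ _⟩
  obtain ⟨Q, rfl⟩ := hs
  refine ⟨Q %ₘ (X ^ p - X - C g), ?_, ?_⟩
  · rw [← degree_artinSchreier hp g]
    exact degree_modByMonic_lt _ (monic_artinSchreier hp g)
  · conv_rhs => rw [← modByMonic_add_div Q (X ^ p - X - C g)]
    simp only [map_add, map_mul, map_sub, map_pow, evalXY_X, evalXY_C]
    rw [curve_eqn, sub_self, zero_mul, add_zero]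

/-- The functions `1, y, ..., y^(p-1)` are linearly independent over `k[x]`. -/
theorem eq_zero_of_evalXY_eq_zero (hp : 1 < p) {Q : k[X][X]} (hQ : Q.degree < p)
    (h : evalXY p g Q = 0) : Q = 0 := by
  set P : k[X][X] := X ^ p - X - C g with hP
  have hroot : AdjoinRoot.root P ^ p - AdjoinRoot.root P
      = aeval (AdjoinRoot.of P X) g := by
    have h1 : AdjoinRoot.mk P P = 0 := AdjoinRoot.mk_self
    have h2 : aeval (AdjoinRoot.of P X) g = AdjoinRoot.of P g := by
      have := aeval_algHom_apply (IsScalarTower.toAlgHom k k[X] (AdjoinRoot P)) X g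
      simpa using this
    rw [h2, ← sub_eq_zero]
    rw [← h1]
    simp [hP, AdjoinRoot.mk_C]
  have hcomp : ((coordLift _ _ hroot).toRingHom.comp (evalXY p g)) = AdjoinRoot.mk P := by
    refine Polynomial.ringHom_ext' ?_ ?_
    · refine Polynomial.ringHom_ext ?_ ?_
      · intro c
        have : (algebraMap k (AdjoinRoot P)) c = AdjoinRoot.of P (C c) := rfl
        simp [this]
      · simp
    · simp
  have hmk : AdjoinRoot.mk P Q = 0 := by
    rw [← hcomp]; simp [h]
  by_contra hne
  refine (monic_artinSchreier hp g).not_dvd_of_degree_lt hne ?_ (AdjoinRoot.mk_eq_zero.mp hmk)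
  rwa [degree_artinSchreier hp]

theorem nontrivial_coordRing (hp : 1 < p) : Nontrivial (CoordRing p g) := by
  refine ⟨0, 1, fun h => one_ne_zero (α := k[X][X]) ?_⟩
  refine eq_zero_of_evalXY_eq_zero (g := g) hp ?_ (by rw [map_one, h])
  rw [degree_one]
  exact_mod_cast (zero_lt_one.trans hp)

/-- A morphism `(x, y) ↦ (u(x), ε (y + h(x)))` of curves, with `u` not constant and `ε` not zero,
is dominant: it is injective on functions. -/
theorem injective_of_xx_of_yy {g' : k[X]} (hp : 1 < p) {u h : k[X]} {ε : k}
    (hu : u.natDegree ≠ 0) (hε : ε ≠ 0) (φ : CoordRing p g →ₐ[k] CoordRing p g')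
    (hx : φ (xx p g) = aeval (xx p g') u)
    (hy : φ (yy p g) = algebraMap k _ ε * (yy p g' + aeval (xx p g') h)) :
    Function.Injective φ := by
  rw [injective_iff_map_eq_zero]
  intro z hz
  obtain ⟨Q, hQ, rfl⟩ := exists_evalXY_eq hp z
  set l : k[X][X] := C (C ε) * X + C (C ε * h) with hl
  have hl1 : l.natDegree = 1 := natDegree_linear (by simpa using hε)
  have hcomp : φ.toRingHom.comp (evalXY p g)
      = (evalXY p g').comp ((compRingHom l).comp (mapRingHom (compRingHom u))) := by
    refine Polynomial.ringHom_ext' ?_ ?_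
    · refine Polynomial.ringHom_ext ?_ ?_
      · intro c; simp
      · simp [hx]
    · simp [hy, hl, mul_add]
  have hQ' : evalXY p g' ((Q.map (compRingHom u)).comp l) = 0 := by
    have := RingHom.congr_fun hcomp Q
    simp only [AlgHom.toRingHom_eq_coe, RingHom.coe_comp, RingHom.coe_coe, Function.comp_apply,
      coe_compRingHom, coe_mapRingHom] at this
    rw [← this, hz]
  have hu' : Function.Injective (compRingHom u : k[X] →+* k[X]) := by
    rw [injective_iff_map_eq_zero]
    intro q hq
    rw [coe_compRingHom_apply, comp_eq_zero_iff] at hq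
    refine hq.resolve_right fun h' => hu ?_
    rw [h'.2, natDegree_C]
  have h0 : (Q.map (compRingHom u)).comp l = 0 := by
    refine eq_zero_of_evalXY_eq_zero hp ?_ hQ'
    by_cases h0 : Q = 0
    · simp [h0, bot_lt_iff_ne_bot]
    · have h1 := (natDegree_lt_iff_degree_lt h0).mpr hQ
      refine degree_le_natDegree.trans_lt ?_
      rw [natDegree_comp, hl1, mul_one, natDegree_map_eq_of_injective hu']
      exact_mod_cast h1
  rw [comp_eq_zero_iff] at h0
  have h1 : Q.map (compRingHom u) = 0 := h0.resolve_right fun h' => by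
    rw [h'.2, natDegree_C] at hl1
    exact zero_ne_one hl1
  rw [(Polynomial.map_eq_zero_iff hu').mp h1, map_zero]

/-- A `k`-algebra isomorphism induces an isomorphism of spectra over `k`. -/
noncomputable def overSpecIso {k S T : Type u} [Field k] [CommRing S] [CommRing T]
    [Algebra k S] [Algebra k T]
    (i : S ≃ₐ[k] T) :
    Over.mk (Spec.map (CommRingCat.ofHom (algebraMap k S))) ≅
      Over.mk (Spec.map (CommRingCat.ofHom (algebraMap k T))) :=
  Over.isoMk (Scheme.Spec.mapIso i.symm.toRingEquiv.toCommRingCatIso.op) (by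
    change Spec.map (CommRingCat.ofHom (i.symm : T →+* S)) ≫ _ = _
    change Spec.map _ ≫ Spec.map _ = Spec.map _
    rw [← Spec.map_comp, ← CommRingCat.ofHom_comp]
    congr 2
    exact i.symm.toAlgHom.comp_algebraMap)

end PlaneCurves

/-! ### Quotients by groups of translations -/

section QuotientCurves

open Polynomial AlgebraicGeometry CategoryTheory

variable {K : Type*} [Field K] {e : ℕ} {a : ℕ → K} {k : Type*} [Field k] [Algebra K k]
  {Fp : Type*} [Field Fp] [Fintype Fp] [Algebra Fp k]

local notation "p" => Fintype.card Fp

/-- A polynomial of degree less than `#s` that vanishes at the points `r i`, `i ∈ s`, is zero if the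
differences of these points are units. -/
theorem eq_zero_of_isUnit_sub {B ι : Type*} [CommRing B] (s : Finset ι) (r : ι → B) (P : B[X])
    (hr : ∀ i ∈ s, ∀ j ∈ s, i ≠ j → IsUnit (r i - r j)) (hP : ∀ i ∈ s, P.eval (r i) = 0)
    (hdeg : P.degree < s.card) : P = 0 := by
  nontriviality B
  by_contra hne
  refine (monic_prod_of_monic s (fun i => X - C (r i))
    fun i _ => monic_X_sub_C _).not_dvd_of_degree_lt hne ?_
    (Finset.prod_dvd_of_coprime ?_ fun i hi => dvd_iff_isRoot.mpr (hP i hi))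
  · rw [degree_prod_of_monic _ _ fun i _ => monic_X_sub_C _]
    simpa using hdeg
  · intro i hi j hj hij
    exact isCoprime_X_sub_C_of_isUnit_sub (hr i hi j hj hij)

theorem action_apply_xx (h : H Fp e a k) : action h (xx p (xR e a k p))
    = xx p (xR e a k p) + algebraMap k _ h.fst := pullback_xx h

theorem action_apply_yy (h : H Fp e a k) : action h (yy p (xR e a k p))
    = yy p (xR e a k p) + f p e a (xx p (xR e a k p)) (algebraMap k _ h.fst)
      + algebraMap k _ h.snd := pullback_yy h

theorem mem_invariants {G : Subgroup (H Fp e a k)} {z : CR e a k Fp} :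
    z ∈ invariants G ↔ ∀ h ∈ G, action h z = z := Iff.rfl

/-- Let `u` be a monic polynomial of degree `#A` that is invariant under translations by `A`, and
`w = ε (y + h(x))`, with `ε^(p-1) = 1`, invariant under a group `G` whose first projection is `A`.
If `w^p - w = c u(x)^2`, then the invariants of `G` are the functions on `y^p - y = c x^2`. Since `x`
is a root of `u(T) - u(x)`, every function is a polynomial in `x` of degree less than `#A` over
`k[u, w]`; if it is invariant, this polynomial takes the same value at the `#A` points `x + α`, so it
is constant. -/
theorem nonempty_invariants_algEquiv (G : Subgroup (H Fp e a k)) (A : Finset k)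
    (hGA : H.fst '' (G : Set (H Fp e a k)) = A) {u h : k[X]} {c ε : k} (hε : ε ≠ 0)
    (hεp : ε ^ p = ε)
    (hu : u.Monic) (hdeg : u.natDegree = A.card)
    (huA : ∀ α ∈ A, u.comp (X + C α) = u)
    (hh : ∀ g ∈ G, h.comp (X + C g.fst) = h - f p e a X (C g.fst) - C g.snd)
    (heq : C ε * (X * R p e a X + (h ^ p - h)) = C c * u ^ 2) :
    Nonempty (invariants G ≃ₐ[k] CoordRing p (C c * X ^ 2 : k[X])) := by
  classical
  have hp : 1 < p := Fintype.one_lt_card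
  have hpull : ∀ g ∈ G, ∀ q : k[X], action g (aeval (xx p (xR e a k p)) q)
      = aeval (xx p (xR e a k p)) (q.comp (X + C g.fst)) := by
    intro g _ q
    have h1 := aeval_algHom_apply (action g).toAlgHom (xx p (xR e a k p)) q
    rw [aeval_comp]
    simp only [map_add, aeval_X, aeval_C]
    rw [← action_apply_xx]
    exact h1.symm
  have hmemA : ∀ g ∈ G, g.fst ∈ A := fun g hg => by
    rw [← Finset.mem_coe, ← hGA]; exact ⟨g, hg, rfl⟩
  have hfB : ∀ α : k, aeval (xx p (xR e a k p)) (f p e a X (C α))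
      = f p e a (xx p (xR e a k p)) (algebraMap k (CR e a k Fp) α) := by
    intro α
    have := map_f ((aeval (xx p (xR e a k p)) : k[X] →ₐ[k] CR e a k Fp).restrictScalars K)
      p e a X (C α)
    simpa using this
  set w : CR e a k Fp := algebraMap k _ ε * (yy p (xR e a k p) + aeval (xx p (xR e a k p)) h)
    with hw
  have hweq : w ^ p - w = aeval (aeval (xx p (xR e a k p)) u) (C c * X ^ 2 : k[X]) := by
    have h2 := curve_eqn p (xR e a k p)
    have h3 : algebraMap k (CR e a k Fp) ε ^ p = algebraMap k (CR e a k Fp) ε := by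
      rw [← map_pow, hεp]
    change C ε * (xR e a k p + (h ^ p - h)) = C c * u ^ 2 at heq
    have h1 := congrArg (aeval (xx p (xR e a k p))) heq
    simp only [map_mul, map_add, map_sub, map_pow, aeval_C, aeval_X] at h1 ⊢
    rw [← h1, hw, mul_pow, add_pow_p, h3]
    linear_combination algebraMap k (CR e a k Fp) ε * h2
  let φ : CoordRing p (C c * X ^ 2 : k[X]) →ₐ[k] CR e a k Fp := coordLift _ _ hweq
  have hφx : φ (xx p _) = aeval (xx p (xR e a k p)) u := coordLift_xx _ _ hweq
  have hφy : φ (yy p _) = w := coordLift_yy _ _ hweq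
  have h0A : (0 : k) ∈ A := hmemA 1 G.one_mem
  have hdeg0 : u.natDegree ≠ 0 := by
    rw [hdeg]; exact Finset.card_ne_zero_of_mem h0A
  have hinj : Function.Injective φ := injective_of_xx_of_yy hp hdeg0 hε φ hφx hφy
  have hfix : ∀ g ∈ G, (action g).toAlgHom.comp φ = φ := by
    intro g hg
    apply coordRing_hom_ext
    · change action g (φ _) = φ _
      rw [hφx, hpull g hg, huA _ (hmemA g hg)]
    · change action g (φ _) = φ _
      rw [hφy, hw, map_mul, AlgEquiv.commutes, map_add, hpull g hg, hh g hg, action_apply_yy]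
      simp only [map_sub, hfB, aeval_C]
      ring
  have hrange : φ.range = invariants G := by
    apply le_antisymm
    · rintro _ ⟨z, rfl⟩
      rw [mem_invariants]
      intro g hg
      exact DFunLike.congr_fun (hfix g hg) z
    · intro z hinv
      have hnt : Nontrivial (CoordRing p (C c * X ^ 2 : k[X])) := nontrivial_coordRing hp
      have h1 : φ.toRingHom.comp (algebraMap k _) = algebraMap k _ := φ.comp_algebraMap
      -- every function is a polynomial in `x` over `k[u, w]`
      have hsurj : ∃ Q : (CoordRing p (C c * X ^ 2 : k[X]))[X],
          eval₂ φ.toRingHom (xx p (xR e a k p)) Q = z := by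
        clear hinv
        have hz : z ∈ Algebra.adjoin k {xx p (xR e a k p), yy p (xR e a k p)} := by
          rw [adjoin_xx_yy]; exact Algebra.mem_top
        induction hz using Algebra.adjoin_induction with
        | mem z hz =>
          rcases hz with rfl | rfl
          · exact ⟨X, eval₂_X _ _⟩
          · refine ⟨C (algebraMap k _ ε⁻¹ * yy p _) - h.map (algebraMap k _), ?_⟩
            rw [eval₂_sub, eval₂_map, eval₂_C, h1]
            change φ _ - aeval _ h = _
            rw [map_mul, AlgHom.commutes, hφy, hw, ← mul_assoc, ← map_mul, inv_mul_cancel₀ hε,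
              map_one, one_mul, add_sub_cancel_right]
        | algebraMap c =>
          refine ⟨C (algebraMap k _ c), ?_⟩
          rw [eval₂_C]
          exact φ.commutes c
        | add z w _ _ hz hw =>
          obtain ⟨P, rfl⟩ := hz
          obtain ⟨Q, rfl⟩ := hw
          exact ⟨P + Q, eval₂_add _ _⟩
        | mul z w _ _ hz hw =>
          obtain ⟨P, rfl⟩ := hz
          obtain ⟨Q, rfl⟩ := hw
          exact ⟨P * Q, eval₂_mul _ _⟩
      obtain ⟨Q₀, hQ₀⟩ := hsurj
      set m : (CoordRing p (C c * X ^ 2 : k[X]))[X] := u.map (algebraMap k _) - C (xx p _) with hm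
      have hudeg : (u.map (algebraMap k (CoordRing p (C c * X ^ 2 : k[X])))).degree = A.card := by
        rw [hu.degree_map, degree_eq_natDegree hu.ne_zero, hdeg]
      have hlt : (C (xx p (C c * X ^ 2 : k[X]))).degree
          < (u.map (algebraMap k (CoordRing p (C c * X ^ 2 : k[X])))).degree := by
        rw [hudeg]
        refine degree_C_le.trans_lt ?_
        exact_mod_cast Finset.card_pos.mpr ⟨0, h0A⟩
      have hmm : m.Monic := (hu.map _).sub_of_left hlt
      have hmdeg : m.degree = A.card := by
        rw [hm, degree_sub_eq_left_of_degree_lt hlt, hudeg]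
      have hmx : eval₂ φ.toRingHom (xx p (xR e a k p)) m = 0 := by
        rw [hm, eval₂_sub, eval₂_map, eval₂_C, h1]
        exact sub_eq_zero.mpr hφx.symm
      set Q := Q₀ %ₘ m with hQ
      have hQx : eval₂ φ.toRingHom (xx p (xR e a k p)) Q = z := by
        rw [← hQ₀]
        conv_rhs => rw [← modByMonic_add_div Q₀ m]
        rw [eval₂_add, eval₂_mul, hmx, zero_mul, add_zero]
      have hQdeg : Q.degree < A.card := hmdeg ▸ degree_modByMonic_lt Q₀ hmm
      have hP : Q.map φ.toRingHom - C z = 0 := by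
        refine eq_zero_of_isUnit_sub A
          (fun α => xx p (xR e a k p) + algebraMap k (CR e a k Fp) α) _ ?_ ?_ ?_
        · intro α _ β _ hαβ
          rw [add_sub_add_left_eq_sub, ← map_sub]
          exact (IsUnit.mk0 _ (sub_ne_zero.mpr hαβ)).map _
        · intro α hα
          rw [← Finset.mem_coe, ← hGA] at hα
          obtain ⟨g, hg, rfl⟩ := hα
          have hgφ : (action g).toAlgHom.toRingHom.comp φ.toRingHom = φ.toRingHom :=
            congrArg AlgHom.toRingHom (hfix g hg)
          rw [eval_sub, eval_C, Polynomial.eval_map, ← action_apply_xx, sub_eq_zero]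
          conv_rhs => rw [← hinv g hg, ← hQx]
          have := hom_eval₂ Q φ.toRingHom (action g).toAlgHom.toRingHom (xx p (xR e a k p))
          rw [hgφ] at this
          exact this.symm
        · refine (degree_sub_le _ _).trans_lt (max_lt (degree_map_le.trans_lt hQdeg) ?_)
          refine degree_C_le.trans_lt ?_
          exact_mod_cast Finset.card_pos.mpr ⟨0, h0A⟩
      have hz0 := congrArg (fun P => coeff P 0) hP
      simp only [coeff_sub, coeff_map, coeff_C_zero, coeff_zero, sub_eq_zero] at hz0
      exact ⟨_, hz0⟩
  exact ⟨((AlgEquiv.ofInjective φ hinj).trans (Subalgebra.equivOfEq _ _ hrange)).symm⟩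

end QuotientCurves

/-! ### Additive polynomials and the Moore matrix -/

section LinearPolynomials

open Polynomial

variable (Fp : Type*) [Fintype Fp] (k : Type*) [Field k]

local notation "p" => Fintype.card Fp

/-- The space of `Fp`-linear (additive) polynomials, spanned by the monomials `X ^ p ^ j`. -/
noncomputable def linearPoly : Submodule k k[X] :=
  Submodule.span k (Set.range fun j : ℕ => (X : k[X]) ^ p ^ j)

variable {Fp k}

theorem X_pow_mem_linearPoly (j : ℕ) : (X : k[X]) ^ p ^ j ∈ linearPoly Fp k :=
  Submodule.subset_span ⟨j, rfl⟩

theorem X_mem_linearPoly : (X : k[X]) ∈ linearPoly Fp k := by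
  simpa using X_pow_mem_linearPoly (Fp := Fp) (k := k) 0

theorem C_mul_mem_linearPoly {P : k[X]} (c : k) (hP : P ∈ linearPoly Fp k) :
    C c * P ∈ linearPoly Fp k := by
  rw [← smul_eq_C_mul]
  exact Submodule.smul_mem _ _ hP

variable [Field Fp]

theorem natDegree_sum_fin_le {e : ℕ} (c : Fin e → k) :
    (∑ j : Fin e, C (c j) * X ^ p ^ (j : ℕ)).natDegree ≤ p ^ (e - 1) := by
  refine natDegree_sum_le_of_forall_le _ _ fun j _ => (natDegree_C_mul_X_pow_le _ _).trans ?_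
  exact Nat.pow_le_pow_right Fintype.card_pos (by omega)

theorem coeff_sum_fin {e : ℕ} (c : Fin e → k) (i : Fin e) :
    (∑ j : Fin e, C (c j) * X ^ p ^ (j : ℕ)).coeff (p ^ (i : ℕ)) = c i := by
  rw [finsetSum_coeff, Finset.sum_eq_single i]
  · simp
  · intro j _ hj
    rw [coeff_C_mul_X_pow, if_neg]
    intro h
    exact hj (Fin.ext (Nat.pow_right_injective Fintype.one_lt_card h)).symm
  · simp

variable [Algebra Fp k]

theorem pow_mem_linearPoly {P : k[X]} (hP : P ∈ linearPoly Fp k) (i : ℕ) :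
    P ^ p ^ i ∈ linearPoly Fp k := by
  induction hP using Submodule.span_induction with
  | mem P hP =>
    obtain ⟨j, rfl⟩ := hP
    simp only [← pow_mul, ← pow_add]
    exact X_pow_mem_linearPoly _
  | zero => rw [zero_pow (pow_pos Fintype.card_pos _).ne']; exact zero_mem _
  | add P Q _ _ hP hQ => rw [add_pow_p_pow]; exact add_mem hP hQ
  | smul c P _ hP => rw [_root_.smul_pow]; exact Submodule.smul_mem _ _ hP

theorem comp_X_add_C_of_mem {P : k[X]} (hP : P ∈ linearPoly Fp k) (α : k) :
    P.comp (X + C α) = P + C (P.eval α) := by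
  induction hP using Submodule.span_induction with
  | mem P hP =>
    obtain ⟨j, rfl⟩ := hP
    simp [add_pow_p_pow]
  | zero => simp
  | add P Q _ _ hP hQ => rw [add_comp, hP, hQ, eval_add, C_add]; ring
  | smul c P _ hP =>
    rw [smul_comp, hP, eval_smul, smul_add, smul_eq_mul, C_mul, smul_C, smul_eq_mul, C_mul]

theorem eval_add_of_mem {P : k[X]} (hP : P ∈ linearPoly Fp k) (x y : k) :
    P.eval (x + y) = P.eval x + P.eval y := by
  have := congrArg (eval x) (comp_X_add_C_of_mem hP y)
  simpa [eval_comp] using this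

theorem eval_smul_of_mem {P : k[X]} (hP : P ∈ linearPoly Fp k) (ξ : Fp) (x : k) :
    P.eval (ξ • x) = ξ • P.eval x := by
  induction hP using Submodule.span_induction with
  | mem P hP =>
    obtain ⟨j, rfl⟩ := hP
    simp [Algebra.smul_def, mul_pow, algebraMap_pow_p_pow]
  | zero => simp
  | add P Q _ _ hP hQ => rw [eval_add, eval_add, hP, hQ, smul_add]
  | smul c P _ hP => rw [Polynomial.eval_smul, Polynomial.eval_smul, hP, smul_comm]

theorem eval_eq_zero_of_basis {ι : Type*} [Fintype ι] {A : Submodule Fp k}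
    (b : Module.Basis ι Fp A) {P : k[X]} (hP : P ∈ linearPoly Fp k)
    (hb : ∀ i, P.eval (b i : k) = 0) (x : k) (hx : x ∈ A) : P.eval x = 0 := by
  let l : k →ₗ[Fp] k :=
    { toFun := fun x => P.eval x
      map_add' := eval_add_of_mem hP
      map_smul' := eval_smul_of_mem hP }
  have h : l.comp A.subtype = 0 := b.ext fun i => hb i
  exact LinearMap.congr_fun h ⟨x, hx⟩

variable {e : ℕ} {A : Submodule Fp k} (b : Module.Basis (Fin e) Fp A)

include b in
theorem card_eq_of_basis {A' : Finset k} (hA' : ∀ x, x ∈ A' ↔ x ∈ A) : A'.card = p ^ e := by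
  have : Fintype A := Fintype.ofEquiv _ b.equivFun.toEquiv.symm
  rw [← Fintype.card_of_subtype A' hA', ← Fintype.card_fin e, ← Module.card_fintype b]

theorem eq_zero_of_degree_lt {P : k[X]} (hP : P ∈ linearPoly Fp k)
    (hdeg : P.natDegree < p ^ e) (hb : ∀ i, P.eval (b i : k) = 0) : P = 0 := by
  classical
  have : Fintype A := Fintype.ofEquiv _ b.equivFun.toEquiv.symm
  refine eq_zero_of_natDegree_lt_card_of_eval_eq_zero' P
    (Finset.univ.map ⟨((↑) : A → k), Subtype.val_injective⟩) ?_ ?_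
  · intro x hx
    simp only [Finset.mem_map, Finset.mem_univ, true_and] at hx
    obtain ⟨y, rfl⟩ := hx
    exact eval_eq_zero_of_basis b hP hb _ y.2
  · rw [Finset.card_map, Finset.card_univ, Module.card_fintype b, Fintype.card_fin]
    exact hdeg

/-- The Moore matrix `(b_i ^ p ^ j)`. -/
noncomputable def mooreMatrix : Matrix (Fin e) (Fin e) k :=
  Matrix.of fun i j => (b i : k) ^ p ^ (j : ℕ)

theorem pow_lt_of_fin (j : Fin e) : p ^ (j : ℕ) < p ^ e :=
  Nat.pow_lt_pow_right Fintype.one_lt_card j.2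

/-- The Moore matrix of a basis is invertible: a vector in its kernel gives an additive polynomial
of degree less than `#A` that vanishes on `A`. -/
theorem isUnit_mooreMatrix : IsUnit (mooreMatrix b) := by
  rw [← Matrix.mulVec_injective_iff_isUnit, ← Matrix.coe_mulVecLin, injective_iff_map_eq_zero]
  intro c hc
  rcases Nat.eq_zero_or_pos e with he | he
  · subst he; exact Subsingleton.elim _ _
  have h0 : (∑ j : Fin e, C (c j) * X ^ p ^ (j : ℕ)) = 0 := by
    refine eq_zero_of_degree_lt b ?_ ?_ ?_
    · exact sum_mem fun j _ => C_mul_mem_linearPoly _ (X_pow_mem_linearPoly _)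
    · exact (natDegree_sum_fin_le c).trans_lt
        (Nat.pow_lt_pow_right Fintype.one_lt_card (by omega))
    · intro i
      have := congrFun hc i
      simp only [Matrix.coe_mulVecLin, Matrix.mulVec, dotProduct, mooreMatrix, Matrix.of_apply,
        Pi.zero_apply] at this
      rw [← this, eval_finsetSum]
      exact Finset.sum_congr rfl fun j _ => by rw [eval_mul, eval_C, eval_pow, eval_X, mul_comm]
  funext i
  rw [← coeff_sum_fin (Fp := Fp) c i, h0, coeff_zero, Pi.zero_apply]

/-- The inverse `N` of the Moore matrix. -/
noncomputable def mooreInv : Matrix (Fin e) (Fin e) k := (mooreMatrix b)⁻¹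

/-- The additive polynomial `L_i` of degree less than `#A` with `L_i(b_l) = δ_{il}`. -/
noncomputable def coordPoly (i : Fin e) : k[X] :=
  ∑ j : Fin e, C (mooreInv b j i) * X ^ p ^ (j : ℕ)

theorem coordPoly_mem (i : Fin e) : coordPoly b i ∈ linearPoly Fp k :=
  sum_mem fun _ _ => C_mul_mem_linearPoly _ (X_pow_mem_linearPoly _)

theorem eval_coordPoly (i l : Fin e) :
    (coordPoly b i).eval (b l : k) = if l = i then 1 else 0 := by
  have h : mooreMatrix b * mooreInv b = 1 :=
    Matrix.mul_nonsing_inv _ ((Matrix.isUnit_iff_isUnit_det _).mp (isUnit_mooreMatrix b))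
  have := congrFun (congrFun h l) i
  rw [Matrix.one_apply, Matrix.mul_apply] at this
  rw [← this, coordPoly, eval_finsetSum]
  exact Finset.sum_congr rfl fun j _ => by
    rw [eval_mul, eval_C, eval_pow, eval_X, mul_comm, mooreMatrix, Matrix.of_apply]

theorem sum_mooreInv_mul_pow (j n : Fin e) :
    ∑ l, mooreInv b j l * (b l : k) ^ p ^ (n : ℕ) = if j = n then 1 else 0 := by
  have h : mooreInv b * mooreMatrix b = 1 :=
    Matrix.nonsing_inv_mul _ ((Matrix.isUnit_iff_isUnit_det _).mp (isUnit_mooreMatrix b))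
  have := congrFun (congrFun h j) n
  rwa [Matrix.one_apply, Matrix.mul_apply] at this

/-- The polynomial `X^(p^e) - ∑ L_i(X) b_i^(p^e)`, which equals `∏_{α ∈ A} (X - α)`. -/
noncomputable def vanishingPoly : k[X] :=
  X ^ p ^ e - ∑ i, C ((b i : k) ^ p ^ e) * coordPoly b i

theorem vanishingPoly_mem : vanishingPoly b ∈ linearPoly Fp k :=
  sub_mem (X_pow_mem_linearPoly _) (sum_mem fun _ _ => C_mul_mem_linearPoly _ (coordPoly_mem b _))

theorem degree_coordSum_lt (c : Fin e → k) :
    (∑ i, C (c i) * coordPoly b i).degree < (p ^ e : ℕ) := by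
  refine (degree_sum_le _ _).trans_lt ?_
  rw [Finset.sup_lt_iff (by exact WithBot.bot_lt_coe _)]
  intro i _
  rw [← smul_eq_C_mul]
  refine (degree_smul_le _ _).trans_lt ?_
  refine (degree_sum_le _ _).trans_lt ?_
  rw [Finset.sup_lt_iff (by exact WithBot.bot_lt_coe _)]
  intro j _
  refine (degree_C_mul_X_pow_le _ _).trans_lt ?_
  exact_mod_cast pow_lt_of_fin j

theorem vanishingPoly_monic : (vanishingPoly b).Monic := by
  refine (monic_X_pow _).sub_of_left ?_
  rw [degree_X_pow]
  exact degree_coordSum_lt b _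

theorem natDegree_vanishingPoly : (vanishingPoly b).natDegree = p ^ e := by
  refine natDegree_eq_of_degree_eq_some ?_
  rw [vanishingPoly, degree_sub_eq_left_of_degree_lt, degree_X_pow]
  rw [degree_X_pow]
  exact degree_coordSum_lt b _

theorem eval_vanishingPoly_basis (l : Fin e) : (vanishingPoly b).eval (b l : k) = 0 := by
  simp [vanishingPoly, eval_finsetSum, eval_coordPoly]

theorem eval_vanishingPoly {x : k} (hx : x ∈ A) : (vanishingPoly b).eval x = 0 :=
  eval_eq_zero_of_basis b (vanishingPoly_mem b) (eval_vanishingPoly_basis b) x hx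

/-- After subtraction of the multiple of `∏_{α ∈ A} (X - α)` with the same coefficient in degree
`#A`, the degree is less than the number of roots. -/
theorem eq_C_mul_vanishingPoly {P : k[X]} (hP : P ∈ linearPoly Fp k)
    (hdeg : P.natDegree ≤ p ^ e) (hb : ∀ i, P.eval (b i : k) = 0) :
    P = C (P.coeff (p ^ e)) * vanishingPoly b := by
  rw [← sub_eq_zero]
  refine eq_zero_of_degree_lt b (sub_mem hP (C_mul_mem_linearPoly _ (vanishingPoly_mem b))) ?_ ?_
  · have h1 : (P - C (P.coeff (p ^ e)) * vanishingPoly b).natDegree ≤ p ^ e := by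
      refine (natDegree_sub_le _ _).trans (max_le hdeg ?_)
      exact (natDegree_C_mul_le _ _).trans (natDegree_vanishingPoly b).le
    have h2 : (P - C (P.coeff (p ^ e)) * vanishingPoly b).coeff (p ^ e) = 0 := by
      have h3 := (vanishingPoly_monic b).coeff_natDegree
      rw [natDegree_vanishingPoly] at h3
      rw [coeff_sub, coeff_C_mul, h3, mul_one, sub_self]
    refine lt_of_le_of_ne h1 fun h => ?_
    have h4 : (P - C (P.coeff (p ^ e)) * vanishingPoly b).coeff _ = _ := coeff_natDegree
    rw [h, h2, eq_comm, leadingCoeff_eq_zero] at h4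
    rw [h4, natDegree_zero] at h
    exact (pow_pos Fintype.card_pos e).ne h
  · intro i
    rw [eval_sub, eval_mul, eval_vanishingPoly_basis, hb, mul_zero, sub_zero]

theorem vanishingPoly_eq_prod {A' : Finset k} (hA' : ∀ x, x ∈ A' ↔ x ∈ A) :
    vanishingPoly b = ∏ α ∈ A', (X - C α) := by
  refine eq_of_monic_of_dvd_of_natDegree_le (monic_prod_of_monic _ _ fun α _ => monic_X_sub_C α)
    (vanishingPoly_monic b) (Finset.prod_dvd_of_coprime ?_ fun α hα => ?_) ?_
  · intro α _ β _ hαβ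
    exact isCoprime_X_sub_C_of_isUnit_sub (IsUnit.mk0 _ (sub_ne_zero.mpr hαβ))
  · exact dvd_iff_isRoot.mpr (eval_vanishingPoly b ((hA' α).mp hα))
  · rw [natDegree_vanishingPoly, natDegree_prod_of_monic _ _ fun α _ => monic_X_sub_C α]
    simp [card_eq_of_basis b hA']

theorem coeff_one_vanishingPoly_eq_prod {A' : Finset k} (hA' : ∀ x, x ∈ A' ↔ x ∈ A) [DecidableEq k]
    (hodd : Odd p) : (vanishingPoly b).coeff 1 = ∏ α ∈ A'.erase 0, α := by
  have h0 : (0 : k) ∈ A' := (hA' 0).mpr A.zero_mem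
  rw [vanishingPoly_eq_prod b hA', ← Finset.mul_prod_erase _ _ h0, C_0, sub_zero]
  rw [coeff_X_mul, coeff_zero_eq_eval_zero, eval_prod]
  simp only [eval_sub, eval_X, eval_C, zero_sub]
  rw [Finset.prod_neg, Finset.card_erase_of_mem h0, card_eq_of_basis b hA']
  rw [Even.neg_one_pow, one_mul]
  exact Nat.Odd.sub_odd (hodd.pow) odd_one

end LinearPolynomials

/-! ### The polynomials `f_R(X, α)` and `ω_R(X, α)` -/

section Translates

open Polynomial

variable {Fp : Type*} [Fintype Fp] {K : Type*} [Field K] {e : ℕ} {a : ℕ → K}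
  {k : Type*} [Field k] [Algebra K k]

local notation "p" => Fintype.card Fp

theorem R_C (x : k) : R p e a (C x : k[X]) = C (R p e a x) :=
  (map_R (IsScalarTower.toAlgHom K k k[X]) p e a x).symm

theorem E_C (x : k) : E p e a (C x : k[X]) = C (E p e a x) :=
  (map_E (IsScalarTower.toAlgHom K k k[X]) p e a x).symm

theorem f_C (x y : k) : f p e a (C x : k[X]) (C y) = C (f p e a x y) :=
  (map_f (IsScalarTower.toAlgHom K k k[X]) p e a x y).symm

theorem f_comp (P Q S : k[X]) : (f p e a P Q).comp S = f p e a (P.comp S) (Q.comp S) :=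
  map_f ((aeval S : k[X] →ₐ[k] k[X]).restrictScalars K) p e a P Q

theorem eval_f (P Q : k[X]) (x : k) :
    (f p e a P Q).eval x = f p e a (P.eval x) (Q.eval x) := by
  have := map_f ((aeval x : k[X] →ₐ[k] k).restrictScalars K) p e a P Q
  simpa [aeval_def] using this

theorem R_X_mem : R p e a (X : k[X]) ∈ linearPoly Fp k :=
  sum_mem fun _ _ => C_mul_mem_linearPoly _ (X_pow_mem_linearPoly _)

theorem eval_omega_X_C (α x : k) : (omega p e a (X : k[X]) (C α)).eval x = omega p e a x α := by
  simp [omega, eval_f]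

variable [Field Fp]

theorem natDegree_f_X_C_lt (α : k) : (f p e a (X : k[X]) (C α)).natDegree < p ^ e := by
  have h1 : 1 < p := Fintype.one_lt_card
  rcases Nat.eq_zero_or_pos e with rfl | he
  · simp [f]
  have hle : (f p e a (X : k[X]) (C α)).natDegree ≤ p ^ (e - 1) := by
    rw [f, natDegree_neg]
    refine natDegree_sum_le_of_forall_le _ _ fun i hi => natDegree_add_le_of_degree_le
      (natDegree_sum_le_of_forall_le _ _ fun j hj => ?_) ?_
    · rw [Finset.mem_range] at hi hj
      refine natDegree_pow_le.trans ?_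
      have : ((algebraMap K k[X]) (a i) * X ^ p ^ i * C α).natDegree ≤ p ^ i :=
        (natDegree_mul_C_le _ _).trans (natDegree_C_mul_X_pow_le (algebraMap K k (a i)) _)
      calc p ^ j * _ ≤ p ^ j * p ^ i := Nat.mul_le_mul_left _ this
        _ = p ^ (j + i) := (pow_add _ _ _).symm
        _ ≤ p ^ (e - 1) := Nat.pow_le_pow_right Fintype.card_pos (by omega)
    · rw [Finset.mem_range] at hi
      refine natDegree_pow_le.trans ?_
      have : (X * R p e a (C α : k[X])).natDegree ≤ 1 := by
        rw [R_C]
        exact (natDegree_mul_C_le _ _).trans natDegree_X_le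
      calc p ^ i * _ ≤ p ^ i * 1 := Nat.mul_le_mul_left _ this
        _ ≤ p ^ (e - 1) := by
          rw [mul_one]; exact Nat.pow_le_pow_right Fintype.card_pos (by omega)
  exact hle.trans_lt (Nat.pow_lt_pow_right h1 (by omega))

variable [Algebra Fp k]

theorem f_X_C_mem (α : k) : f p e a (X : k[X]) (C α) ∈ linearPoly Fp k := by
  refine neg_mem (sum_mem fun i _ => add_mem (sum_mem fun j _ => pow_mem_linearPoly ?_ j)
    (pow_mem_linearPoly ?_ i))
  · rw [mul_comm]
    exact C_mul_mem_linearPoly _ (C_mul_mem_linearPoly _ (X_pow_mem_linearPoly _))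
  · rw [R_C, mul_comm]
    exact C_mul_mem_linearPoly _ X_mem_linearPoly

theorem f_C_X_mem (α : k) : f p e a (C α) (X : k[X]) ∈ linearPoly Fp k := by
  refine neg_mem (sum_mem fun i _ => add_mem (sum_mem fun j _ => pow_mem_linearPoly ?_ j)
    (pow_mem_linearPoly ?_ i))
  · rw [← C_pow, mul_assoc]
    exact C_mul_mem_linearPoly _ (C_mul_mem_linearPoly _ X_mem_linearPoly)
  · exact C_mul_mem_linearPoly _ R_X_mem

theorem omega_X_C_mem (α : k) : omega p e a (X : k[X]) (C α) ∈ linearPoly Fp k :=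
  sub_mem (f_X_C_mem α) (f_C_X_mem α)

/-- `ω_R(X, α)^p - ω_R(X, α) = α^(p^e) E_R(X)` for `α ∈ V_R`. -/
theorem omega_X_C_pow_sub {α : k} (hα : E p e a α = 0) :
    omega p e a (X : k[X]) (C α) ^ p - omega p e a (X : k[X]) (C α) = C α ^ p ^ e * E p e a X := by
  have h1 := f_pow_sub Fp e a (X : k[X]) (C α)
  have h2 := f_pow_sub Fp e a (C α) (X : k[X])
  rw [E_C, hα, C_0] at h1
  rw [omega, sub_pow_p]
  linear_combination h1 - h2

variable {A : Submodule Fp k} (b : Module.Basis (Fin e) Fp A)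

theorem sum_mooreInv_mul_f_C_X (he : 0 < e) :
    ∑ l, C (mooreInv b ⟨0, he⟩ l) * f p e a (C (b l : k)) (X : k[X])
      = -(C (algebraMap K k (a 0)) * X + R p e a X) := by
  have hN : ∀ n < e, ∑ l, C (mooreInv b ⟨0, he⟩ l) * C (b l : k) ^ p ^ n
      = if n = 0 then 1 else 0 := by
    intro n hn
    have := congrArg (C : k → k[X]) (sum_mooreInv_mul_pow b ⟨0, he⟩ ⟨n, hn⟩)
    rw [map_sum] at this
    simp only [C_mul, C_pow, Fin.mk.injEq] at this
    rw [this, apply_ite C, C_1, C_0]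
    simp [eq_comm]
  have hf : ∀ l, C (mooreInv b ⟨0, he⟩ l) * f p e a (C (b l : k)) (X : k[X])
      = -∑ i ∈ Finset.range e, ((∑ j ∈ Finset.range (e - i),
          C (mooreInv b ⟨0, he⟩ l) * C (b l : k) ^ p ^ (i + j)
            * (algebraMap K k[X] (a i) * X) ^ p ^ j)
        + C (mooreInv b ⟨0, he⟩ l) * C (b l : k) ^ p ^ i * R p e a X ^ p ^ i) := by
    intro l
    rw [f, mul_neg, Finset.mul_sum]
    congr 1
    refine Finset.sum_congr rfl fun i _ => ?_
    rw [mul_add, Finset.mul_sum]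
    refine congrArg₂ (· + ·) ?_ ?_
    · refine Finset.sum_congr rfl fun j _ => ?_
      rw [pow_add, pow_mul, mul_comm (algebraMap K k[X] (a i)), mul_assoc (C (b l : k) ^ p ^ i),
        mul_pow, mul_assoc]
    · rw [mul_pow, mul_assoc]
  rw [Finset.sum_congr rfl fun l _ => hf l, Finset.sum_neg_distrib, Finset.sum_comm]
  congr 1
  have hi : ∀ i ∈ Finset.range e, (∑ l, ((∑ j ∈ Finset.range (e - i),
          C (mooreInv b ⟨0, he⟩ l) * C (b l : k) ^ p ^ (i + j)
            * (algebraMap K k[X] (a i) * X) ^ p ^ j)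
        + C (mooreInv b ⟨0, he⟩ l) * C (b l : k) ^ p ^ i * R p e a X ^ p ^ i))
      = if i = 0 then C (algebraMap K k (a 0)) * X + R p e a X else 0 := by
    intro i hi
    rw [Finset.mem_range] at hi
    rw [Finset.sum_add_distrib, Finset.sum_comm]
    simp only [← Finset.sum_mul]
    rw [hN i hi, Finset.sum_congr rfl fun j hj => by
      rw [hN (i + j) (by rw [Finset.mem_range] at hj; omega)]]
    rcases eq_or_ne i 0 with rfl | hi0
    · simp [he, ite_mul]
    · simp [hi0]
  rw [Finset.sum_congr rfl hi, Finset.sum_ite_eq' _ 0, if_pos (Finset.mem_range.mpr he)]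

end Translates

/-! ### Bilinearity of `f_R` and `ω_R` -/

section Bilinearity

variable (Fp : Type*) [Field Fp] [Fintype Fp] {K : Type*} [Field K] (e : ℕ) (a : ℕ → K)
  {B : Type*} [CommRing B] [Algebra Fp B] [Algebra K B]

local notation "p" => Fintype.card Fp

theorem f_smul_left (ξ : Fp) (x y : B) : f p e a (ξ • x) y = ξ • f p e a x y := by
  simp only [f, Algebra.smul_def, mul_neg, Finset.mul_sum, mul_add, mul_pow, algebraMap_pow_p_pow]
  congr 1
  refine Finset.sum_congr rfl fun i _ => congrArg₂ (· + ·) (Finset.sum_congr rfl fun j _ => ?_) ?_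
  all_goals ring

theorem f_smul_right (ξ : Fp) (x y : B) : f p e a x (ξ • y) = ξ • f p e a x y := by
  simp only [f, R_smul]
  simp only [Algebra.smul_def, mul_neg, Finset.mul_sum, mul_add, mul_pow, algebraMap_pow_p_pow]
  congr 1
  refine Finset.sum_congr rfl fun i _ => congrArg₂ (· + ·) (Finset.sum_congr rfl fun j _ => ?_) ?_
  all_goals ring

theorem omega_add_left (x x' y : B) :
    omega p e a (x + x') y = omega p e a x y + omega p e a x' y := by
  rw [omega, f_add_left, f_add_right, omega, omega]; ring

theorem omega_add_right (x y y' : B) :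
    omega p e a x (y + y') = omega p e a x y + omega p e a x y' := by
  rw [omega, f_add_left, f_add_right, omega, omega]; ring

theorem omega_smul_left (ξ : Fp) (x y : B) : omega p e a (ξ • x) y = ξ • omega p e a x y := by
  rw [omega, f_smul_left, f_smul_right, omega, smul_sub]

theorem omega_smul_right (ξ : Fp) (x y : B) : omega p e a x (ξ • y) = ξ • omega p e a x y := by
  rw [omega, f_smul_left, f_smul_right, omega, smul_sub]

end Bilinearity

/-! ### The invariant function `y + h(x)` -/

section QuadraticForm

open Polynomial

variable {Fp : Type*} [Field Fp] [Fintype Fp] {K : Type*} [Field K] {e : ℕ} {a : ℕ → K}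
  {k : Type*} [Field k] [Algebra Fp k] [Algebra K k]
  {A : Submodule Fp k} (b : Module.Basis (Fin e) Fp A)

local notation "p" => Fintype.card Fp

theorem coeff_one_coordPoly (he : 0 < e) (i : Fin e) :
    (coordPoly b i).coeff 1 = mooreInv b ⟨0, he⟩ i := by
  have := coeff_sum_fin (Fp := Fp) (fun j => mooreInv b j i) ⟨0, he⟩
  rwa [pow_zero] at this

theorem coeff_one_pow_card (P : k[X]) : (P ^ p).coeff 1 = 0 := by
  have h : derivative (P ^ p) = 0 := by
    rw [derivative_pow, show ((p : ℕ) : k) = 0 by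
      rw [← map_natCast (algebraMap Fp k), Nat.cast_card_eq_zero, map_zero]]
    simp
  have h1 := coeff_derivative (P ^ p) 0
  rw [h] at h1
  simpa using h1.symm

theorem coeff_one_vanishingPoly_eq_neg_sum (he : 0 < e) : (vanishingPoly b).coeff 1
    = -∑ i, (b i : k) ^ p ^ e * mooreInv b ⟨0, he⟩ i := by
  have h : (X ^ p ^ e : k[X]).coeff 1 = 0 := by
    rw [coeff_X_pow, if_neg]
    exact (Nat.one_lt_pow he.ne' Fintype.one_lt_card).ne
  simp only [vanishingPoly, coeff_sub, h, finsetSum_coeff, coeff_C_mul, coeff_one_coordPoly b he,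
    zero_sub]

/-- `L_i^p - L_i` vanishes on `A` and has degree at most `#A`. -/
theorem exists_coordPoly_pow_sub (he : 0 < e) (i : Fin e) :
    ∃ m : k, coordPoly b i ^ p - coordPoly b i = C m * vanishingPoly b ∧
      m * (vanishingPoly b).coeff 1 = -mooreInv b ⟨0, he⟩ i := by
  have hL : (coordPoly b i).natDegree ≤ p ^ (e - 1) := natDegree_sum_fin_le _
  have h1 := eq_C_mul_vanishingPoly b (P := coordPoly b i ^ p - coordPoly b i) ?_ ?_ ?_
  · refine ⟨_, h1, ?_⟩
    have h2 := congrArg (coeff · 1) h1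
    beta_reduce at h2
    rw [coeff_sub, coeff_C_mul, coeff_one_pow_card, coeff_one_coordPoly b he, zero_sub] at h2
    exact h2.symm
  · refine sub_mem ?_ (coordPoly_mem b i)
    simpa using pow_mem_linearPoly (coordPoly_mem b i) 1
  · refine (natDegree_sub_le _ _).trans (max_le (natDegree_pow_le.trans ?_) (hL.trans ?_))
    · calc p * _ ≤ p * p ^ (e - 1) := Nat.mul_le_mul_left _ hL
        _ = p ^ e := mul_pow_sub_one he.ne' _
    · exact Nat.pow_le_pow_right Fintype.card_pos (by omega)
  · intro l
    rw [eval_sub, eval_pow, eval_coordPoly]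
    split <;> simp [Fintype.card_ne_zero]

theorem coeff_one_vanishingPoly_ne_zero (he : 0 < e) : (vanishingPoly b).coeff 1 ≠ 0 := by
  intro h
  have hN : ∀ i, mooreInv b ⟨0, he⟩ i = 0 := fun i => by
    obtain ⟨m, -, hm⟩ := exists_coordPoly_pow_sub b he i
    rw [h, mul_zero] at hm
    exact neg_eq_zero.mp hm.symm
  have := sum_mooreInv_mul_pow b ⟨0, he⟩ ⟨0, he⟩
  simp [hN] at this

/-- Both sides are additive polynomials of degree at most `#A` that vanish on `A`: in
`∑ N_{0i} f_R(b_i, X)` all powers `b_i^(p^j)` cancel except for `j = 0`, which leaves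
`-(a_0 X + R(X))`, while `f_R(X, b_i)` has degree less than `#A`. -/
theorem sum_mooreInv_mul_omega (he : 0 < e) (hA : IsTotallyIsotropic e a A) :
    ∑ i, C (mooreInv b ⟨0, he⟩ i) * omega p e a X (C (b i : k))
      = C (algebraMap K k (a e)) * vanishingPoly b := by
  have h0 : ∑ i, C (mooreInv b ⟨0, he⟩ i) * omega p e a X (C (b i : k))
      = ∑ i, C (mooreInv b ⟨0, he⟩ i) * f p e a X (C (b i : k))
        + C (algebraMap K k (a 0)) * X
        + ∑ i ∈ Finset.range e, algebraMap K k[X] (a i) * X ^ p ^ i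
        + C (algebraMap K k (a e)) * X ^ p ^ e := by
    simp only [omega, mul_sub, Finset.sum_sub_distrib, sum_mooreInv_mul_f_C_X b he]
    rw [R, Finset.sum_range_succ]
    have : algebraMap K k[X] (a e) = C (algebraMap K k (a e)) := rfl
    rw [this]
    ring
  have hlow : (∑ i, C (mooreInv b ⟨0, he⟩ i) * f p e a X (C (b i : k))
        + C (algebraMap K k (a 0)) * X
        + ∑ i ∈ Finset.range e, algebraMap K k[X] (a i) * X ^ p ^ i).natDegree < p ^ e := by
    have hpos : 0 < p ^ e := pow_pos Fintype.card_pos e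
    have h1 : 1 < p ^ e := Nat.one_lt_pow he.ne' Fintype.one_lt_card
    refine (natDegree_add_le _ _).trans_lt (max_lt
      ((natDegree_add_le _ _).trans_lt (max_lt ?_ ?_)) ?_)
    · refine (natDegree_sum_le_of_forall_le (n := p ^ e - 1) _ _ fun i _ => ?_).trans_lt
        (Nat.sub_lt hpos one_pos)
      exact (natDegree_C_mul_le _ _).trans (Nat.le_sub_one_of_lt (natDegree_f_X_C_lt _))
    · exact (natDegree_C_mul_le _ _).trans_lt (natDegree_X_le.trans_lt h1)
    · refine (natDegree_sum_le_of_forall_le (n := p ^ e - 1) _ _ fun i hi => ?_).trans_lt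
        (Nat.sub_lt hpos one_pos)
      refine (natDegree_C_mul_X_pow_le (algebraMap K k (a i)) _).trans (Nat.le_sub_one_of_lt ?_)
      exact Nat.pow_lt_pow_right Fintype.one_lt_card (Finset.mem_range.mp hi)
  have h1 := eq_C_mul_vanishingPoly b
    (P := ∑ i, C (mooreInv b ⟨0, he⟩ i) * omega p e a X (C (b i : k))) ?_ ?_ ?_
  · rw [h1]
    congr 2
    rw [h0, coeff_add, coeff_eq_zero_of_natDegree_lt hlow, coeff_C_mul_X_pow, if_pos rfl, zero_add]
  · exact sum_mem fun i _ => C_mul_mem_linearPoly _ (omega_X_C_mem _)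
  · rw [h0]
    exact (natDegree_add_le _ _).trans (max_le hlow.le (natDegree_C_mul_X_pow_le _ _))
  · intro l
    rw [eval_finsetSum]
    refine Finset.sum_eq_zero fun i _ => ?_
    rw [eval_mul, eval_omega_X_C, hA.2 _ (b l).2 _ (b i).2, mul_zero]

/-- The coordinates of `α ∈ A` with respect to `b` are the values `L_i(α)`. -/
theorem sum_coordPoly_mul_omega {α : k} (hα : α ∈ A) :
    ∑ i, C ((coordPoly b i).eval α) * omega p e a X (C (b i : k)) = omega p e a X (C α) := by
  let l₁ : k →ₗ[Fp] k[X] :=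
    { toFun := fun α => ∑ i, C ((coordPoly b i).eval α) * omega p e a X (C (b i : k))
      map_add' := fun α β => by
        simp only [eval_add_of_mem (coordPoly_mem b _), C_add, add_mul, Finset.sum_add_distrib]
      map_smul' := fun ξ α => by
        simp only [eval_smul_of_mem (coordPoly_mem b _), ← smul_C, smul_mul_assoc,
          Finset.smul_sum, RingHom.id_apply] }
  let l₂ : k →ₗ[Fp] k[X] :=
    { toFun := fun α => omega p e a X (C α)
      map_add' := fun α β => by rw [C_add, omega_add_right]
      map_smul' := fun ξ α => by rw [← smul_C, omega_smul_right, RingHom.id_apply] }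
  have h : l₁.comp A.subtype = l₂.comp A.subtype := b.ext fun l => by
    change ∑ i, C ((coordPoly b i).eval (b l : k)) * omega p e a X (C (b i : k))
      = omega p e a X (C (b l : k))
    simp [eval_coordPoly]
  exact LinearMap.congr_fun h ⟨α, hα⟩

/-- The function `-(f_R(X,X) + ∑ L_i(X) ω_R(X, b_i)) / 2`; adding it to `y` gives a function on
`C_R` that is invariant under `A`. The factor `1/2` is taken in `Fp`, where the Frobenius fixes it. -/
noncomputable def correction (a : ℕ → K) : k[X] :=
  -C (algebraMap Fp k 2⁻¹) * (f p e a X X + ∑ i, coordPoly b i * omega p e a X (C (b i : k)))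

theorem correction_comp (hp : Odd p) (hA : IsTotallyIsotropic e a A) {α : k} (hα : α ∈ A) :
    (correction b a).comp (X + C α)
      = correction b a - f p e a X (C α) - C (f p e a α α / 2) := by
  have h2 : (2 : k) ≠ 0 := two_ne_zero_of_odd hp
  set t : k[X] := C (algebraMap Fp k 2⁻¹) with ht
  have ht2 : t * 2 = 1 := by
    rw [ht, ← C_ofNat, ← C_mul, map_inv₀, map_ofNat, inv_mul_cancel₀ h2, C_1]
  have hW : ∀ i, (omega p e a X (C (b i : k))).comp (X + C α) = omega p e a X (C (b i : k)) := by
    intro i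
    rw [comp_X_add_C_of_mem (omega_X_C_mem _), eval_omega_X_C, hA.2 _ hα _ (b i).2, C_0, add_zero]
  have hdiv : C (f p e a α α / 2) = t * f p e a (C α) (C α) := by
    rw [f_C, ht, ← C_mul, map_inv₀, map_ofNat, div_eq_inv_mul]
  have hω := sum_coordPoly_mul_omega (a := a) b hα
  rw [omega] at hω
  rw [correction, ← ht, mul_comp, neg_comp, add_comp, f_comp, X_comp, Polynomial.sum_comp, hdiv]
  simp only [mul_comp, hW, comp_X_add_C_of_mem (coordPoly_mem b _), add_mul,
    Finset.sum_add_distrib]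
  rw [hω, ht, C_comp, ← ht, f_add_left, f_add_right, f_add_right]
  linear_combination -f p e a X (C α) * ht2

/-- With `x R(x) = y^p - y` the left-hand side is `w^p - w` for `w = y + h(x)`. -/
theorem correction_artinSchreier (hp : Odd p) (he : 0 < e) (hA : IsTotallyIsotropic e a A) :
    X * R p e a X + (correction b a ^ p - correction b a)
      = C (algebraMap K k (a e) / 2 * ((vanishingPoly b).coeff 1)⁻¹) * vanishingPoly b ^ 2 := by
  have h2 : (2 : k) ≠ 0 := two_ne_zero_of_odd hp
  set t : k[X] := C (algebraMap Fp k 2⁻¹) with ht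
  have ht2 : t * 2 = 1 := by
    rw [ht, ← C_ofNat, ← C_mul, map_inv₀, map_ofNat, inv_mul_cancel₀ h2, C_1]
  have htp : t ^ p = t := by rw [ht, ← C_pow, algebraMap_pow_p]
  set u := vanishingPoly b with hu
  choose m hm hm1 using exists_coordPoly_pow_sub b he
  have hf0 := coeff_one_vanishingPoly_ne_zero b he
  have hE : ∀ i, E p e a (b i : k) = 0 := fun i => hA.1 (b i).2
  -- the Artin-Schreier class of the correction
  have hpow : correction b a ^ p - correction b a
      = -t * ((f p e a X X ^ p - f p e a X X)
        + ∑ i, (coordPoly b i ^ p * omega p e a X (C (b i : k)) ^ p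
          - coordPoly b i * omega p e a X (C (b i : k)))) := by
    rw [correction, ← ht, mul_pow, neg_pow_p, htp, add_pow_p, sum_pow_p, Finset.sum_sub_distrib]
    simp only [mul_pow]
    ring
  have hterm : ∀ i, coordPoly b i ^ p * omega p e a X (C (b i : k)) ^ p
          - coordPoly b i * omega p e a X (C (b i : k))
      = u * (C (m i) * omega p e a X (C (b i : k)))
        + (C (m i * (b i : k) ^ p ^ e) * (u * E p e a X)
        + C ((b i : k) ^ p ^ e) * coordPoly b i * E p e a X) := by
    intro i
    have h1 := omega_X_C_pow_sub (hE i)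
    have h3 := hm i
    rw [C_mul, C_pow]
    linear_combination omega p e a X (C (b i : k)) ^ p * h3
      + (coordPoly b i + C (m i) * u) * h1
  have hsum1 : ∑ i, m i * (b i : k) ^ p ^ e = 1 := by
    apply mul_right_cancel₀ hf0
    rw [Finset.sum_mul, one_mul]
    conv_rhs => rw [coeff_one_vanishingPoly_eq_neg_sum b he, ← Finset.sum_neg_distrib]
    refine Finset.sum_congr rfl fun i _ => ?_
    linear_combination (b i : k) ^ p ^ e * hm1 i
  have hsum2 : ∑ i, C (m i) * omega p e a X (C (b i : k))
      = -C (algebraMap K k (a e) * (u.coeff 1)⁻¹) * u := by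
    have hmi : ∀ i, m i = -(u.coeff 1)⁻¹ * mooreInv b ⟨0, he⟩ i := fun i => by
      apply mul_right_cancel₀ hf0
      rw [hm1 i, mul_assoc, mul_comm (mooreInv b ⟨0, he⟩ i), ← mul_assoc, neg_mul,
        inv_mul_cancel₀ hf0, neg_one_mul]
    simp only [hmi, C_mul, mul_assoc]
    rw [← Finset.mul_sum, sum_mooreInv_mul_omega b he hA]
    rw [C_neg]; ring
  have hsum3 : ∑ i, C ((b i : k) ^ p ^ e) * coordPoly b i = X ^ p ^ e - u := by
    rw [hu, vanishingPoly, sub_sub_cancel]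
  have hff := f_pow_sub Fp e a (X : k[X]) X
  have hc : C (algebraMap K k (a e) / 2 * (u.coeff 1)⁻¹)
      = t * C (algebraMap K k (a e) * (u.coeff 1)⁻¹) := by
    rw [ht, ← C_mul, map_inv₀, map_ofNat]
    congr 1
    ring
  rw [hpow, hc, Finset.sum_congr rfl fun i _ => hterm i, Finset.sum_add_distrib,
    Finset.sum_add_distrib, ← Finset.mul_sum, ← Finset.sum_mul, ← Finset.sum_mul, ← map_sum,
    hsum1, hsum2, hsum3, hff, C_1]
  linear_combination -(X * R p e a X) * ht2

end QuadraticForm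

/-! ### Maximal totally isotropic subspaces -/

section Lagrangian

open Polynomial

variable {Fp : Type*} [Fintype Fp] {K : Type*} [Field K] {e : ℕ} {a : ℕ → K}
  {F : Type*} [Field F] [Algebra K F]

local notation "p" => Fintype.card Fp

theorem eval_E_X (x : F) : (E p e a (X : F[X])).eval x = E p e a x := by
  have := map_E ((aeval x : F[X] →ₐ[F] F).restrictScalars K) p e a X
  simpa [aeval_def] using this

theorem E_X_of_eq_zero :
    E p 0 a (X : F[X]) = C (2 * algebraMap K F (a 0)) * X := by
  have h : algebraMap K F[X] (a 0) = C (algebraMap K F (a 0)) := rfl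
  rw [E, R, C_mul, C_ofNat, ← h]
  simp
  ring

variable [Field Fp]

theorem natDegree_R_X (ha : a e ≠ 0) : (R p e a (X : F[X])).natDegree = p ^ e := by
  have hae : algebraMap K F (a e) ≠ 0 := by simpa using ha
  have htop : (algebraMap K F[X] (a e) * X ^ p ^ e).natDegree = p ^ e :=
    natDegree_C_mul_X_pow _ _ hae
  have hlow : (∑ i ∈ Finset.range e, algebraMap K F[X] (a i) * X ^ p ^ i).natDegree < p ^ e := by
    have hpos : 0 < p ^ e := pow_pos Fintype.card_pos e
    refine (natDegree_sum_le_of_forall_le (n := p ^ e - 1) _ _ fun i hi => ?_).trans_lt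
      (Nat.sub_lt hpos one_pos)
    refine (natDegree_C_mul_X_pow_le (algebraMap K F (a i)) _).trans (Nat.le_sub_one_of_lt ?_)
    exact Nat.pow_lt_pow_right Fintype.one_lt_card (Finset.mem_range.mp hi)
  rw [R, Finset.sum_range_succ, natDegree_add_eq_right_of_natDegree_lt (by rwa [htop]), htop]

variable [Algebra Fp F]

theorem derivative_pow_card_pow (P : F[X]) {n : ℕ} (hn : n ≠ 0) :
    derivative (P ^ p ^ n) = 0 := by
  have h : ((p : ℕ) : F) = 0 := by
    rw [← map_natCast (algebraMap Fp F), Nat.cast_card_eq_zero, map_zero]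
  rw [derivative_pow, Nat.cast_pow, h, zero_pow hn]
  simp

theorem natDegree_E_X (hp : Odd p) (ha : a e ≠ 0) :
    (E p e a (X : F[X])).natDegree = p ^ (2 * e) := by
  have h2 : (2 : F) ≠ 0 := two_ne_zero_of_odd hp
  have hae : algebraMap K F (a e) ≠ 0 := by simpa using ha
  rcases Nat.eq_zero_or_pos e with rfl | he
  · rw [E_X_of_eq_zero, natDegree_C_mul_X _ (mul_ne_zero h2 hae)]
    simp
  have htop : (R p e a (X : F[X]) ^ p ^ e).natDegree = p ^ (2 * e) := by
    rw [natDegree_pow, natDegree_R_X ha, ← pow_add, two_mul]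
  have hlow : (∑ i ∈ Finset.range (e + 1),
      (algebraMap K F[X] (a i) * X) ^ p ^ (e - i)).natDegree ≤ p ^ e := by
    refine natDegree_sum_le_of_forall_le _ _ fun i _ => natDegree_pow_le.trans ?_
    have h1 : (algebraMap K F[X] (a i) * X).natDegree ≤ 1 :=
      (natDegree_C_mul_le (algebraMap K F (a i)) _).trans natDegree_X_le
    calc p ^ (e - i) * _ ≤ p ^ (e - i) * 1 := Nat.mul_le_mul_left _ h1
      _ ≤ p ^ e := by rw [mul_one]; exact Nat.pow_le_pow_right Fintype.card_pos (Nat.sub_le _ _)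
  rw [E, natDegree_add_eq_left_of_natDegree_lt, htop]
  rw [htop]
  exact hlow.trans_lt (Nat.pow_lt_pow_right Fintype.one_lt_card (by omega))

theorem separable_E_X (hp : Odd p) (ha : a e ≠ 0) : (E p e a (X : F[X])).Separable := by
  have h2 : (2 : F) ≠ 0 := two_ne_zero_of_odd hp
  have hae : algebraMap K F (a e) ≠ 0 := by simpa using ha
  suffices h : ∃ c : F, c ≠ 0 ∧ derivative (E p e a (X : F[X])) = C c by
    obtain ⟨c, hc, h⟩ := h
    rw [Separable, h]
    exact isCoprime_one_right.of_isCoprime_of_dvd_right (isUnit_C.mpr (IsUnit.mk0 _ hc)).dvd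
  rcases Nat.eq_zero_or_pos e with rfl | he
  · exact ⟨_, mul_ne_zero h2 hae, by rw [E_X_of_eq_zero, derivative_C_mul_X]⟩
  refine ⟨_, hae, ?_⟩
  rw [E, derivative_add, derivative_pow_card_pow _ he.ne', Finset.sum_range_succ, zero_add,
    derivative_add, derivative_sum, Finset.sum_eq_zero, zero_add, Nat.sub_self, pow_zero, pow_one]
  · exact derivative_C_mul_X (algebraMap K F (a e))
  · intro i hi
    rw [Finset.mem_range] at hi
    exact derivative_pow_card_pow _ (by omega)

theorem mem_roots_E_X (hp : Odd p) (ha : a e ≠ 0) {x : F} :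
    x ∈ (E p e a (X : F[X])).roots ↔ x ∈ V Fp e a F := by
  rw [mem_roots (separable_E_X hp ha).ne_zero, IsRoot.def, eval_E_X]
  rfl

theorem finite_V (hp : Odd p) (ha : a e ≠ 0) : Finite (V Fp e a F) := by
  classical
  refine Set.Finite.subset (E p e a (X : F[X])).roots.toFinset.finite_toSet fun x hx => ?_
  rw [Finset.mem_coe, Multiset.mem_toFinset]
  exact (mem_roots_E_X hp ha).mpr hx

theorem finrank_V [IsAlgClosed F] (hp : Odd p) (ha : a e ≠ 0) :
    Module.finrank Fp (V Fp e a F) = 2 * e := by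
  classical
  have := finite_V (F := F) hp ha
  apply Nat.pow_right_injective (Fintype.one_lt_card : 1 < p)
  change p ^ _ = p ^ _
  rw [← natDegree_E_X (F := F) hp ha]
  have hcard : p ^ Module.finrank Fp (V Fp e a F) = Nat.card (V Fp e a F) := by
    rw [Module.natCard_eq_pow_finrank (K := Fp), Nat.card_eq_fintype_card]
  rw [hcard, (IsAlgClosed.splits _).natDegree_eq_card_roots,
    ← Multiset.toFinset_card_of_nodup (nodup_roots (separable_E_X hp ha))]
  exact Nat.subtype_card _ fun x => by rw [Multiset.mem_toFinset]; exact mem_roots_E_X hp ha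

/-- `ω_R` takes values in `Fp` on `V_R`. -/
theorem exists_algebraMap_eq_omega {x y : F} (hx : E p e a x = 0) (hy : E p e a y = 0) :
    ∃ ξ : Fp, algebraMap Fp F ξ = omega p e a x y := by
  classical
  have hz : omega p e a x y ^ p = omega p e a x y := by
    have h1 := f_pow_sub Fp e a x y
    have h2 := f_pow_sub Fp e a y x
    rw [hy] at h1
    rw [hx] at h2
    rw [← sub_eq_zero, omega, sub_pow_p]
    linear_combination h1 - h2
  by_contra! hne
  -- otherwise `X^p - X` would have `p + 1` roots
  refine FiniteField.X_pow_card_sub_X_ne_zero F (Fintype.one_lt_card : 1 < p)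
    (eq_zero_of_natDegree_lt_card_of_eval_eq_zero' _
      (insert (omega p e a x y) (Finset.univ.image (algebraMap Fp F))) ?_ ?_)
  · intro z hz'
    rw [Finset.mem_insert, Finset.mem_image] at hz'
    rw [eval_sub, eval_pow, eval_X, sub_eq_zero]
    rcases hz' with rfl | ⟨ξ, -, rfl⟩
    · exact hz
    · exact algebraMap_pow_p Fp ξ
  · rw [Finset.card_insert_of_notMem (by simpa using hne),
      Finset.card_image_of_injective _ (algebraMap Fp F).injective, Finset.card_univ,
      FiniteField.X_pow_card_sub_X_natDegree_eq F Fintype.one_lt_card]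
    exact Nat.lt_succ_self _

/-- The form `ω_R` on `V_R`, with values in `Fp`. -/
theorem exists_form (Fp : Type*) [Field Fp] [Fintype Fp] (e : ℕ) (a : ℕ → K)
    (F : Type*) [Field F] [Algebra Fp F] [Algebra K F] :
    ∃ B : LinearMap.BilinForm Fp (V Fp e a F), ∀ x y : V Fp e a F,
      algebraMap Fp F (B x y) = omega (Fintype.card Fp) e a (x : F) (y : F) := by
  choose g hg using fun x y : V Fp e a F => exists_algebraMap_eq_omega (Fp := Fp) x.2 y.2
  refine ⟨LinearMap.mk₂ Fp g ?_ ?_ ?_ ?_, hg⟩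
  all_goals
    intros
    apply (algebraMap Fp F).injective
    simp only [hg, map_add, smul_eq_mul, map_mul, Submodule.coe_add, Submodule.coe_smul,
      omega_add_left, omega_add_right, omega_smul_left, omega_smul_right,
      ← Algebra.smul_def]

/-- The form `ω_R` is nondegenerate. If `ω_R(·, α)` vanishes on `V_R`, then `W = ω_R(X, α)` is a
multiple of the separable polynomial `E_R(X)`; but `W^p - W = α^(p^e) E_R(X)`, so `W` has smaller
degree than `E_R(X)` unless it is zero. -/
theorem eq_zero_of_omega_eq_zero [IsAlgClosed F] (hp : Odd p) (ha : a e ≠ 0) {α : F}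
    (hα : E p e a α = 0) (h : ∀ x : F, E p e a x = 0 → omega p e a x α = 0) : α = 0 := by
  set W : F[X] := omega p e a X (C α) with hW
  have hsep := separable_E_X (F := F) hp ha
  have hdvd : E p e a (X : F[X]) ∣ W := by
    by_cases hW0 : W = 0
    · rw [hW0]; exact dvd_zero _
    refine (IsAlgClosed.splits _).dvd_of_roots_le_roots hsep.ne_zero ?_
    refine (Multiset.le_iff_subset (nodup_roots hsep)).mpr fun x hx => ?_
    rw [mem_roots hW0, IsRoot.def, eval_omega_X_C]
    exact h x ((mem_roots_E_X hp ha).mp hx)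
  have hWp := omega_X_C_pow_sub (a := a) hα
  rw [← hW, ← C_pow] at hWp
  have hW0 : W = 0 := by
    by_contra hW0
    have h1 : (E p e a (X : F[X])).natDegree ≤ W.natDegree := natDegree_le_of_dvd hdvd hW0
    have h2 : 0 < W.natDegree := by
      refine lt_of_lt_of_le ?_ h1
      rw [natDegree_E_X hp ha]
      exact pow_pos Fintype.card_pos _
    have h3 : W.natDegree < (W ^ p).natDegree := by
      rw [natDegree_pow]
      exact lt_mul_of_one_lt_left h2 Fintype.one_lt_card
    have h4 := congrArg natDegree hWp
    rw [natDegree_sub_eq_left_of_natDegree_lt h3] at h4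
    exact absurd (h4.le.trans ((natDegree_C_mul_le _ _).trans h1)) (not_le.mpr h3)
  rw [hW0, zero_pow Fintype.card_ne_zero, sub_zero, eq_comm, mul_eq_zero, C_eq_zero] at hWp
  exact pow_eq_zero_iff (pow_pos Fintype.card_pos _).ne' |>.mp (hWp.resolve_right hsep.ne_zero)

/-- A maximal totally isotropic subspace is its own orthogonal complement in `V_R`. -/
theorem finrank_of_maximal [IsAlgClosed F] (hp : Odd p) (ha : a e ≠ 0) {A : Submodule Fp F}
    (hA : Maximal (IsTotallyIsotropic e a) A) : Module.finrank Fp A = e := by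
  obtain ⟨B, hB⟩ := exists_form Fp e a F
  have := finite_V (F := F) hp ha
  have hfd : FiniteDimensional Fp (V Fp e a F) := Module.Finite.of_finite
  have halt : ∀ x y : F, omega p e a x y = -omega p e a y x := fun x y => by
    rw [omega, omega, neg_sub]
  have hB0 : ∀ x y, B x y = 0 ↔ omega p e a (x : F) (y : F) = 0 := fun x y => by
    rw [← hB, map_eq_zero (algebraMap Fp F)]
  have hnd : B.Nondegenerate := by
    constructor
    · intro x hx
      refine Subtype.ext (eq_zero_of_omega_eq_zero hp ha x.2 fun y hy => ?_)
      rw [halt, (hB0 x ⟨y, hy⟩).mp (hx _), neg_zero]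
    · intro x hx
      exact Subtype.ext (eq_zero_of_omega_eq_zero hp ha x.2 fun y hy =>
        (hB0 ⟨y, hy⟩ x).mp (hx _))
  set W : Submodule Fp (V Fp e a F) := A.comap (V Fp e a F).subtype with hW
  have hort : B.orthogonal W = W := by
    apply le_antisymm
    · intro x hx
      rw [LinearMap.BilinForm.mem_orthogonal_iff] at hx
      have hxA : ∀ y ∈ A, omega p e a y (x : F) = 0 := fun y hy =>
        (hB0 ⟨y, hA.prop.1 hy⟩ x).mp (hx _ hy)
      -- `A + Fp x` is totally isotropic
      have hiso : IsTotallyIsotropic e a (A ⊔ Submodule.span Fp {(x : F)}) := by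
        refine ⟨sup_le hA.prop.1 ((Submodule.span_singleton_le_iff_mem _ _).mpr x.2), ?_⟩
        intro y hy z hz
        obtain ⟨y, hyA, y', hy', rfl⟩ := Submodule.mem_sup.mp hy
        obtain ⟨z, hzA, z', hz', rfl⟩ := Submodule.mem_sup.mp hz
        obtain ⟨ξ, rfl⟩ := Submodule.mem_span_singleton.mp hy'
        obtain ⟨η, rfl⟩ := Submodule.mem_span_singleton.mp hz'
        have hxx : omega p e a (x : F) (x : F) = 0 := sub_self _
        simp only [omega_add_left, omega_add_right, omega_smul_left, omega_smul_right, hxx,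
          hxA y hyA, halt (x : F) z, hxA z hzA, hA.prop.2 y hyA z hzA, neg_zero, smul_zero,
          add_zero]
      exact hA.le_of_ge hiso le_sup_left
        (Submodule.mem_sup_right (Submodule.mem_span_singleton_self _))
    · intro x hx
      rw [LinearMap.BilinForm.mem_orthogonal_iff]
      exact fun y hy => (hB0 y x).mpr (hA.prop.2 _ hy _ hx)
  have hdim := LinearMap.BilinForm.finrank_orthogonal hnd W
  rw [hort, finrank_V hp ha] at hdim
  have hle := Submodule.finrank_le W
  rw [finrank_V hp ha] at hle
  rw [← (Submodule.comapSubtypeEquivOfLe hA.prop.1).finrank_eq]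
  change Module.finrank Fp W = e
  omega

end Lagrangian

/-! ### Descent to the field `k` -/

section Descent

variable {Fp Fq F : Type*} [Field Fp] [Field Fq] [Algebra Fp Fq]
  [Field F] [Algebra Fp F] [Algebra Fq F] [IsScalarTower Fp Fq F]
  {e : ℕ} {a : ℕ → Fq} (k : IntermediateField Fq F)

/-- The elements of `A` that lie in `k`. -/
noncomputable def restrictToField (A : Submodule Fp F) : Submodule Fp k :=
  A.comap (k.val.restrictScalars Fp).toLinearMap

variable {k}

theorem mem_restrictToField {A : Submodule Fp F} {x : k} :
    x ∈ restrictToField k A ↔ (x : F) ∈ A := Iff.rfl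

theorem finite_restrictToField {A : Submodule Fp F} (hA : (A : Set F).Finite) :
    (restrictToField k A : Set k).Finite :=
  (hA.preimage Subtype.val_injective.injOn : ((Subtype.val : k → F) ⁻¹' (A : Set F)).Finite)

theorem finrank_restrictToField {A : Submodule Fp F} (hk : ∀ x ∈ A, x ∈ k) :
    Module.finrank Fp (restrictToField k A) = Module.finrank Fp A := by
  have hinj : Function.Injective (k.val.restrictScalars Fp).toLinearMap := Subtype.val_injective
  rw [(Submodule.equivMapOfInjective _ hinj (restrictToField k A)).finrank_eq, restrictToField,
    Submodule.map_comap_eq_of_le]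
  exact fun x hx => ⟨⟨x, hk x hx⟩, rfl⟩

variable [Fintype Fp]

local notation "p" => Fintype.card Fp

theorem isTotallyIsotropic_restrictToField {A : Submodule Fp F} (hA : IsTotallyIsotropic e a A) :
    IsTotallyIsotropic e a (restrictToField k A) := by
  refine ⟨fun x hx => ?_, fun x hx y hy => ?_⟩
  · apply (Subtype.val_injective : Function.Injective k.val)
    change k.val (E p e a x) = k.val 0
    rw [map_E, map_zero]
    exact hA.1 hx
  · apply (Subtype.val_injective : Function.Injective k.val)
    change k.val (omega p e a x y) = k.val 0
    rw [omega, map_sub, map_f, map_f, map_zero]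
    exact hA.2 _ hx _ hy

theorem map_embed (hp : Odd p) {A : Submodule Fp F} (hA : IsTotallyIsotropic e a A)
    (x : restrictToField k A) :
    H.map k.val (embed hp (isTotallyIsotropic_restrictToField (k := k) hA) (Multiplicative.ofAdd x))
      = embed hp hA (Multiplicative.ofAdd ⟨x, mem_restrictToField.mp x.2⟩) := by
  refine H.ext rfl ?_
  change k.val (f p e a (x : k) (x : k) / 2) = f p e a ((x : k) : F) ((x : k) : F) / 2
  rw [map_div₀, map_f, map_ofNat]
  rfl

/-- The subgroup `A` of the Heisenberg group consists of elements with coordinates in `k`. -/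
theorem mem_comap_range_embed (hp : Odd p) {A : Submodule Fp F} (hA : IsTotallyIsotropic e a A)
    (g : H Fp e a k) : g ∈ (embed hp hA).range.comap (H.map k.val) ↔
      g.fst ∈ restrictToField k A ∧ g.snd = f p e a g.fst g.fst / 2 := by
  constructor
  · rintro ⟨x, hx⟩
    have h1 : (x.toAdd : F) = g.fst := congrArg H.fst hx
    have h2 : f p e a (x.toAdd : F) (x.toAdd : F) / 2 = g.snd := congrArg H.snd hx
    refine ⟨mem_restrictToField.mpr (h1 ▸ x.toAdd.2),
      (Subtype.val_injective : Function.Injective k.val) ?_⟩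
    change k.val g.snd = k.val (f p e a g.fst g.fst / 2)
    rw [map_div₀, map_f, map_ofNat]
    exact (h1 ▸ h2).symm
  · rintro ⟨h1, h2⟩
    refine ⟨_, (map_embed hp hA ⟨g.fst, h1⟩).symm.trans (congrArg _ (H.ext rfl h2.symm))⟩

end Descent

section Constant

open Polynomial

variable {Fp : Type*} [Field Fp] [Fintype Fp] {K : Type*} [Field K] {e : ℕ} {a : ℕ → K}
  {k : Type*} [Field k] [Algebra Fp k] [Algebra K k]
  {A : Submodule Fp k} (b : Module.Basis (Fin e) Fp A)

local notation "p" => Fintype.card Fp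

theorem correction_artinSchreier_cA (hp : Odd p) (hA : IsTotallyIsotropic e a A) :
    C ((-1) ^ e) * (X * R p e a X + (correction b a ^ p - correction b a))
      = C (cA e a A) * vanishingPoly b ^ 2 := by
  classical
  rcases Nat.eq_zero_or_pos e with rfl | he
  · have : (correction b a) = 0 := by simp [correction, f]
    simp [this, vanishingPoly, cA, R, Fintype.card_ne_zero]
    ring
  have := Module.Finite.of_basis b
  have : Finite A := Module.finite_of_finite Fp
  have hfin : (A : Set k).Finite := this
  have hset : {α : k | α ∈ A ∧ α ≠ 0} = (hfin.toFinset.erase 0 : Finset k) := by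
    ext α
    simp
  rw [correction_artinSchreier b hp he hA,
    coeff_one_vanishingPoly_eq_prod b (A' := hfin.toFinset) (fun x => by simp) hp,
    cA, if_neg he.ne', hset, finprod_mem_coe_finset, Finset.prod_inv_distrib, ← mul_assoc, ← C_mul,
    mul_assoc]

end Constant

section Descent

variable {Fp Fq F : Type*} [Field Fp] [Field Fq] [Algebra Fp Fq]
  [Field F] [Algebra Fp F] [Algebra Fq F] [IsScalarTower Fp Fq F]

theorem coe_cA_restrictToField (e : ℕ) (a : ℕ → Fq) {k : IntermediateField Fq F}
    {A : Submodule Fp F} (hA : (A : Set F).Finite) (hk : ∀ x ∈ A, x ∈ k) :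
    ((cA e a (restrictToField k A) : k) : F) = cA e a A := by
  rw [cA, cA]
  split_ifs with he
  · rfl
  have hset : {α : F | α ∈ A ∧ α ≠ 0} =
      Subtype.val '' {α : k | α ∈ restrictToField k A ∧ α ≠ 0} := by
    ext α
    constructor
    · rintro ⟨h, h0⟩
      exact ⟨⟨α, hk α h⟩, ⟨h, fun h' => h0 (congrArg Subtype.val h')⟩, rfl⟩
    · rintro ⟨x, ⟨h, h0⟩, rfl⟩
      exact ⟨h, fun h' => h0 (Subtype.ext h')⟩
  have hfin : {α : k | α ∈ restrictToField k A ∧ α ≠ 0}.Finite :=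
    Set.Finite.subset (finite_restrictToField hA) fun x hx => hx.1
  rw [hset, finprod_mem_image Subtype.val_injective.injOn]
  change k.val ((-1) ^ e * (algebraMap Fq k (a e) / 2)
    * ∏ᶠ α ∈ {α : k | α ∈ restrictToField k A ∧ α ≠ 0}, α⁻¹) = _
  have hprod := (k.val : k →* F).map_finprod_mem (fun α => α⁻¹) hfin
  simp only [MonoidHom.coe_coe, map_inv₀] at hprod
  rw [map_mul, map_mul, map_div₀, map_pow, map_neg, map_one, map_ofNat, AlgHom.commutes, hprod]
  rfl

end Descent

end VanDerGeerVlugt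

open VanDerGeerVlugt

theorem propositionA4 {Fp Fq F : Type*}
    [Field Fp] [Fintype Fp]
    [Field Fq] [Finite Fq] [Algebra Fp Fq]
    [Field F] [Algebra Fp F] [Algebra Fq F] [IsScalarTower Fp Fq F] [IsAlgClosure Fq F]
    (hp : Odd (Fintype.card Fp))
    (e : ℕ) (a : ℕ → Fq) (ha : a e ≠ 0)
    (A : Submodule Fp F) (hA : Maximal (VanDerGeerVlugt.IsTotallyIsotropic e a) A)
    (k : IntermediateField Fq F) (hk : ∀ x ∈ A, x ∈ k) :
    ∃ c : k, (c : F) = VanDerGeerVlugt.cA e a A ∧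
      Nonempty
        (VanDerGeerVlugt.quotientCurve
            ((VanDerGeerVlugt.embed hp hA.prop).range.comap (VanDerGeerVlugt.H.map k.val)) ≅
          VanDerGeerVlugt.curve (Fintype.card Fp)
            (Polynomial.C c * Polynomial.X ^ 2 : Polynomial k)) := by
  have := IsAlgClosure.isAlgClosed (R := Fq) (K := F)
  have hfinV := finite_V (Fp := Fp) (F := F) hp ha
  have hAfin : (A : Set F).Finite := Set.Finite.subset (Set.toFinite (V Fp e a F : Set F)) hA.prop.1
  have hAk := isTotallyIsotropic_restrictToField (k := k) hA.prop
  have hAkfin : (restrictToField k A : Set k).Finite := finite_restrictToField hAfin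
  have : Finite (restrictToField k A) := hAkfin
  have : Module.Finite Fp (restrictToField k A) := Module.Finite.of_finite
  let b : Module.Basis (Fin e) Fp (restrictToField k A) :=
    Module.finBasisOfFinrankEq Fp _
      ((finrank_restrictToField hk).trans (finrank_of_maximal hp ha hA))
  refine ⟨cA e a (restrictToField k A), coe_cA_restrictToField e a hAfin hk, ?_⟩
  have hmem : ∀ x, x ∈ hAkfin.toFinset ↔ x ∈ restrictToField k A := fun x => by simp
  have himage : H.fst '' ((embed hp hA.prop).range.comap (H.map k.val) : Set (H Fp e a k))
      = hAkfin.toFinset := by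
    ext α
    constructor
    · rintro ⟨g, hg, rfl⟩
      exact Finset.mem_coe.mpr ((hmem _).mpr ((mem_comap_range_embed hp hA.prop g).mp hg).1)
    · intro hα
      have hα := (hmem α).mp hα
      exact ⟨embed hp hAk (Multiplicative.ofAdd ⟨α, hα⟩),
        (mem_comap_range_embed hp hA.prop _).mpr ⟨hα, rfl⟩, rfl⟩
  -- `-w` in place of `w` changes the sign of the constant
  refine (nonempty_invariants_algEquiv _ _ himage (u := vanishingPoly b) (h := correction b a)
    (ε := (-1) ^ e) (pow_ne_zero _ (neg_ne_zero.mpr one_ne_zero))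
    (by rw [← pow_mul, mul_comm, pow_mul, hp.neg_one_pow]) (vanishingPoly_monic b)
    ((natDegree_vanishingPoly b).trans (card_eq_of_basis b hmem).symm) ?_ ?_
    (correction_artinSchreier_cA b hp hAk)).map overSpecIso
  · intro α hα
    rw [comp_X_add_C_of_mem (vanishingPoly_mem b), eval_vanishingPoly b ((hmem α).mp hα),
      Polynomial.C_0, add_zero]
  · intro g hg
    obtain ⟨h1, h2⟩ := (mem_comap_range_embed hp hA.prop g).mp hg
    rw [correction_comp b hp hAk h1, h2]
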